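/- Let $d\ge 1$ be an integer and let $0<m<M$; write $\kappa:=M/m$. Let $\mathcal F$ be the class of functions $f:\mathbb R^d\to\mathbb R$ that are - separable: $f(x)=\sum_{i=1}^d f_i([Ux]_i)$ for some orthogonal matrix $U\in\mathbb R^{d\times d}$ and some functions $f_1,\dots,f_d:\mathbb R\to\mathbb R$; - $m$-strongly convex; and - $M$-smooth: differentiable with $M$-Lipschitz gradient, in the Euclidean norm. Every $f\in\mathcal F$ has a unique minimizer $x^*$. Given i.i.d. real random variables (stepsizes) $\alpha_0,\alpha_1,\dots$, $f\in\mathcal F$ and $x_0\in\mathbb R^d$ with $x_0\ne x^*$, let gradient descent be $x_{t+1}=x_t-\alpha_t\nabla f(x_t)$, and put $$R_n:=\left(\frac{\|x_n-x^*\|}{\|x_0-x^*\|}\right)^{1/n},\qquad R_{\mathrm{acc}}:=\frac{\sqrt\kappa-1}{\sqrt\kappa+1}.$$ Let $\mathrm{Arcsine}(m,M)$ be the probability distribution on $\mathbb R$ with density $\dfrac{\mathbf 1_{\beta\in(m,M)}}{\pi\sqrt{(M-\beta)(\beta-m)}}$. 1. If the inverse stepsizes $\alpha_t^{-1}$ are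 i.i.d. $\mathrm{Arcsine}(m,M)$, then for every $f\in\mathcal F$ and every $x_0\neq x^*$, $R_n\to R_{\mathrm{acc}}$ as $n\to\infty$, almost surely and in $L^1$. 2. This is the unique i.i.d. stepsize distribution that attains this rate over $\mathcal F$: if the i.i.d. stepsizes $\alpha_t$ have any distribution on $\mathbb R$ such that, for every $f\in\mathcal F$ and every $x_0\ne x^*$, $\Pr[R_n\ge R_{\mathrm{acc}}+\varepsilon]\to 0$ as $n\to\infty$ for all $\varepsilon>0$ (in particular, if for every such $f$ and $x_0$ one has $R_n\to R_{\mathrm{acc}}$ almost surely, or $\limsup_n R_n\le R_{\mathrm{acc}}$ almost surely, or $R_n\to R_{\mathrm{acc}}$ in $L^1$), then $\alpha_t^{-1}\sim\mathrm{Arcsine}(m,M)$. -/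

import Mathlib

open MeasureTheory ProbabilityTheory Filter Topology

/-- A function `f : ℝᵈ → ℝ` is separable if `f x = ∑ i, g i ((U x) i)` for some orthogonal
matrix `U` and some univariate functions `g i`. -/
def IsSeparableFun {d : ℕ} (f : EuclideanSpace ℝ (Fin d) → ℝ) : Prop :=
  ∃ U ∈ Matrix.orthogonalGroup (Fin d) ℝ, ∃ g : Fin d → ℝ → ℝ,
    ∀ x : EuclideanSpace ℝ (Fin d), f x = ∑ i, g i (Matrix.mulVec U x.ofLp i)

/-- `f` is `M`-smooth: differentiable with `M`-Lipschitz gradient (Euclidean norm). -/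
def IsSmoothFun {d : ℕ} (M : ℝ) (f : EuclideanSpace ℝ (Fin d) → ℝ) : Prop :=
  Differentiable ℝ f ∧ ∀ x y, ‖gradient f x - gradient f y‖ ≤ M * ‖x - y‖

/-- The iterates of gradient descent on `f` with stepsizes `a 0, a 1, …`, started at `x₀`. -/
noncomputable def gdIterate {d : ℕ} (f : EuclideanSpace ℝ (Fin d) → ℝ) (a : ℕ → ℝ)
    (x₀ : EuclideanSpace ℝ (Fin d)) : ℕ → EuclideanSpace ℝ (Fin d)
  | 0 => x₀
  | n + 1 => gdIterate f a x₀ n - a n • gradient f (gdIterate f a x₀ n)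

/-- The average contraction factor `(‖xₙ - x⋆‖ / ‖x₀ - x⋆‖) ^ (1 / n)` of the first `n` steps of
gradient descent (its value at `n = 0` is the irrelevant default `1`). -/
noncomputable def gdRate {d : ℕ} (f : EuclideanSpace ℝ (Fin d) → ℝ)
    (xstar x₀ : EuclideanSpace ℝ (Fin d)) (a : ℕ → ℝ) (n : ℕ) : ℝ :=
  (‖gdIterate f a x₀ n - xstar‖ / ‖x₀ - xstar‖) ^ (1 / (n : ℝ))

/-- The Arcsine distribution on `(m, M)`, with density `1 / (π √((M - β) (β - m)))`. -/
noncomputable def arcsineMeasure (m M : ℝ) : Measure ℝ :=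
  (volume.restrict (Set.Ioo m M)).withDensity
    fun β => ENNReal.ofReal (1 / (Real.pi * Real.sqrt ((M - β) * (β - m))))

/-- The accelerated rate `(√κ - 1) / (√κ + 1)` for the condition number `κ = M / m`. -/
noncomputable def acceleratedRate (m M : ℝ) : ℝ :=
  (Real.sqrt (M / m) - 1) / (Real.sqrt (M / m) + 1)

/-! In the separating basis each error coordinate satisfies `z (n+1) = z n * (1 - α n * h (z n))`,
where `h` is a secant slope of a univariate derivative and takes values in `[m, M]`. The slope is
chosen by the past, but the Arcsine law makes the choice immaterial: its logarithmic potential is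
constant on its support, so the mean of `log |1 - x / β|` is `log R_acc` for every `x ∈ [m, M]`
(`integral_log_arcsineMeasure`).

For convergence this identity is strengthened to a moment bound of order `s`, namely `exp (s * log
R_acc + K * s ^ 2)`, uniform in `x` and valid for small `s` of either sign
(`exists_lintegral_rpow_arcsineMeasure_le`). Since `α n` is independent of `z n`, the bound
multiplies along the recursion. Summability of the weighted moments gives almost sure exponential
bounds, above from `s > 0` and below from `s < 0`. A deterministic bound on the rate then gives
convergence in `L¹`.

For uniqueness only the quadratics `c / 2 * ‖x‖ ^ 2` are needed. The strong law turns the hypothesis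
into the statement that the `ν`-mean of `log |1 - a * c|` is at most `log R_acc`. Put `c = 1 / s`
and average over `s` Arcsine on `[1/M, 1/m]`. By the same potential identity with the roles of `a`
and `s` exchanged, every stepsize `a` averages to at least `log R_acc`, with equality only for `a ∈
[1/M, 1/m]`. By Fubini all these inequalities are equalities, so `ν` lives on `[1/M, 1/m]` and has
constant mean log-contraction for almost every `s`. The kernel `log |cos θ - cos φ|` is diagonal in
the functions `cos (n * θ)` with nonzero eigenvalues for `n ≥ 1`, so this constancy fixes every
Chebyshev moment of `ν`. The inverse Arcsine law satisfies the same equations, and a compactly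
supported law is determined by its polynomial moments. -/

/-! ### Cosine parametrization of the Arcsine law and its singular integrals -/

open Real in
theorem sin_sq_sub_sin_sq (A B : ℝ) : sin A ^ 2 - sin B ^ 2 = sin (A + B) * sin (A - B) := by
  rw [sin_add, sin_sub]
  nlinarith [sin_sq_add_cos_sq A, sin_sq_add_cos_sq B]

-- In the product formula for `cos θ - cos φ`, the factor `sin ((θ + φ) / 2)` dominates `|sin ((θ -
-- φ) / 2)|`, because their squares differ by `sin θ * sin φ ≥ 0`. Jordan's inequality for the
-- smaller factor then bounds both.
open Real in
theorem mul_sq_sub_le_abs_cos_sub_cos {θ φ : ℝ} (hθ : θ ∈ Set.Icc 0 π) (hφ : φ ∈ Set.Icc 0 π) :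
    2 / π ^ 2 * (θ - φ) ^ 2 ≤ |cos θ - cos φ| := by
  have hpi := pi_pos
  obtain ⟨h1, h2⟩ := hθ
  obtain ⟨h3, h4⟩ := hφ
  have hB : |(θ - φ) / 2| ≤ π / 2 := by rw [abs_le]; constructor <;> linarith
  have hJ := mul_abs_le_abs_sin hB
  have hA : 0 ≤ sin ((θ + φ) / 2) := sin_nonneg_of_nonneg_of_le_pi (by linarith) (by linarith)
  have hAB : |sin ((θ - φ) / 2)| ≤ sin ((θ + φ) / 2) := by
    have e := sin_sq_sub_sin_sq ((θ + φ) / 2) ((θ - φ) / 2)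
    have e1 : (θ + φ) / 2 + (θ - φ) / 2 = θ := by ring
    have e2 : (θ + φ) / 2 - (θ - φ) / 2 = φ := by ring
    rw [e1, e2] at e
    have := mul_nonneg (sin_nonneg_of_nonneg_of_le_pi h1 h2) (sin_nonneg_of_nonneg_of_le_pi h3 h4)
    exact abs_le_of_sq_le_sq (by linarith) hA
  rw [cos_sub_cos, abs_mul, abs_mul, abs_of_nonneg hA]
  have h0 : 0 ≤ 2 / π * |(θ - φ) / 2| := by positivity
  have key : (2 / π * |(θ - φ) / 2|) ^ 2 ≤ sin ((θ + φ) / 2) * |sin ((θ - φ) / 2)| := by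
    rw [sq]; exact mul_le_mul (hJ.trans hAB) hJ h0 hA
  have e3 : (2 / π * |(θ - φ) / 2|) ^ 2 = (θ - φ) ^ 2 / π ^ 2 := by
    rw [mul_pow, sq_abs]; field_simp
  rw [e3] at key
  have e4 : 2 / π ^ 2 * (θ - φ) ^ 2 = 2 * ((θ - φ) ^ 2 / π ^ 2) := by ring
  rw [e4, abs_neg, abs_two, mul_assoc]
  linarith

theorem exists_integral_abs_sub_rpow_le : ∃ K : ℝ, ∀ φ ∈ Set.Icc 0 Real.pi,
    IntegrableOn (fun θ : ℝ => |θ - φ| ^ (-(1 / 2) : ℝ)) (Set.Ioo 0 Real.pi) ∧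
      ∫ θ in Set.Ioo 0 Real.pi, |θ - φ| ^ (-(1 / 2) : ℝ) ≤ K := by
  have h : IntegrableOn (fun u : ℝ => |u| ^ (-(1 / 2) : ℝ)) (Set.Ioo (-Real.pi) Real.pi) := by
    have h0 : IntervalIntegrable (fun u : ℝ => |u| ^ (-(1 / 2) : ℝ)) volume (-Real.pi) Real.pi := by
      refine intervalIntegrable_of_even (fun x => by simp) fun x hx => ?_
      refine (intervalIntegral.intervalIntegrable_rpow' (r := -(1 / 2)) (by norm_num)).congr ?_
      intro u hu
      rw [Set.uIoc_of_le hx.le] at hu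
      simp only [abs_of_pos hu.1]
    exact (intervalIntegrable_iff_integrableOn_Ioo_of_le (by linarith [Real.pi_pos])).1 h0
  refine ⟨∫ u in Set.Ioo (-Real.pi) Real.pi, |u| ^ (-(1 / 2) : ℝ), fun φ hφ => ?_⟩
  have hmp := measurePreserving_sub_right volume φ
  have hme := measurableEmbedding_subRight φ
  have h2 := (hmp.integrableOn_comp_preimage hme (f := fun u : ℝ => |u| ^ (-(1 / 2) : ℝ))
    (s := Set.Ioo (-Real.pi) Real.pi)).2 h
  have hs : Set.Ioo 0 Real.pi ⊆ (fun x => x - φ) ⁻¹' (Set.Ioo (-Real.pi) Real.pi) := by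
    intro x hx
    simp only [Set.mem_preimage, Set.mem_Ioo, Set.mem_Icc] at *
    constructor <;> linarith
  refine ⟨h2.mono_set hs, ?_⟩
  rw [← hmp.setIntegral_preimage_emb hme (fun u : ℝ => |u| ^ (-(1 / 2) : ℝ))
    (Set.Ioo (-Real.pi) Real.pi)]
  exact setIntegral_mono_set h2 (ae_of_all _ fun x => by positivity) hs.eventuallyLE

/-- The affine image in `[p, q]` of `cos θ`. -/
noncomputable def arcsinePoint (p q θ : ℝ) : ℝ := (p + q) / 2 + (q - p) / 2 * Real.cos θ

theorem continuous_arcsinePoint (p q : ℝ) : Continuous (arcsinePoint p q) := by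
  unfold arcsinePoint; fun_prop

theorem arcsinePoint_mem_Ioo {p q θ : ℝ} (hpq : p < q) (hθ : θ ∈ Set.Ioo 0 Real.pi) :
    arcsinePoint p q θ ∈ Set.Ioo p q := by
  have h1 : Real.cos θ < 1 := by
    rw [← Real.cos_zero]
    exact Real.strictAntiOn_cos ⟨le_rfl, Real.pi_pos.le⟩ ⟨hθ.1.le, hθ.2.le⟩ hθ.1
  have h2 : -1 < Real.cos θ := by
    rw [← Real.cos_pi]
    exact Real.strictAntiOn_cos ⟨hθ.1.le, hθ.2.le⟩ ⟨Real.pi_pos.le, le_rfl⟩ hθ.2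
  unfold arcsinePoint
  constructor <;> nlinarith

theorem exists_arcsinePoint_eq {p q x : ℝ} (hpq : p < q) (hx : x ∈ Set.Icc p q) :
    ∃ φ ∈ Set.Icc 0 Real.pi, arcsinePoint p q φ = x := by
  have hb : 0 < q - p := by linarith
  refine ⟨Real.arccos ((x - (p + q) / 2) / ((q - p) / 2)), ⟨Real.arccos_nonneg _,
    Real.arccos_le_pi _⟩, ?_⟩
  unfold arcsinePoint
  rw [Real.cos_arccos]
  · field_simp; ring
  · rw [le_div_iff₀ (by linarith)]; linarith [hx.1]
  · rw [div_le_iff₀ (by linarith)]; linarith [hx.2]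

/-- In the variable `θ` the difference vanishes at most quadratically, so the power `-1/4` costs
only the integrable singularity `|θ - φ| ^ (-1/2)`. The point is that `K` does not depend on `x`:
this is the source of all later uniformity in the curvature. -/
theorem exists_integral_abs_sub_arcsinePoint_rpow_le {p q : ℝ} (hpq : p < q) :
    ∃ K : ℝ, ∀ x ∈ Set.Icc p q,
      IntegrableOn (fun θ => |x - arcsinePoint p q θ| ^ (-(1 / 4) : ℝ)) (Set.Ioo 0 Real.pi) ∧
        ∫ θ in Set.Ioo 0 Real.pi, |x - arcsinePoint p q θ| ^ (-(1 / 4) : ℝ) ≤ K := by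
  obtain ⟨K, hK⟩ := exists_integral_abs_sub_rpow_le
  have hpi := Real.pi_pos
  set c : ℝ := (q - p) / 2 * (2 / Real.pi ^ 2) with hc
  have hc0 : 0 < c := by have : 0 < q - p := by linarith
                         positivity
  refine ⟨c ^ (-(1 / 4) : ℝ) * K, fun x hx => ?_⟩
  obtain ⟨φ, hφ, rfl⟩ := exists_arcsinePoint_eq hpq hx
  obtain ⟨hi, hle⟩ := hK φ hφ
  have hbd : ∀ θ ∈ Set.Ioo 0 Real.pi,
      |arcsinePoint p q φ - arcsinePoint p q θ| ^ (-(1 / 4) : ℝ) ≤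
        c ^ (-(1 / 4) : ℝ) * |θ - φ| ^ (-(1 / 2) : ℝ) := by
    intro θ hθ
    -- On the diagonal both sides are zero, since `Real.rpow` gives `0` for a nonzero power of `0`.
    rcases eq_or_ne θ φ with rfl | hne
    · simp only [sub_self, abs_zero]
      rw [Real.zero_rpow (by norm_num), Real.zero_rpow (by norm_num)]; simp
    have h1 := mul_sq_sub_le_abs_cos_sub_cos ⟨hθ.1.le, hθ.2.le⟩ hφ
    have h2 : arcsinePoint p q φ - arcsinePoint p q θ =
        -((q - p) / 2 * (Real.cos θ - Real.cos φ)) := by unfold arcsinePoint; ring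
    have h3 : 0 < |θ - φ| := abs_pos.2 (sub_ne_zero.2 hne)
    have h4 : c * |θ - φ| ^ (2 : ℝ) ≤ |arcsinePoint p q φ - arcsinePoint p q θ| := by
      rw [h2, abs_neg, abs_mul, abs_of_pos (by linarith : 0 < (q - p) / 2), hc, Real.rpow_two,
        sq_abs, mul_assoc]
      exact mul_le_mul_of_nonneg_left h1 (by linarith)
    calc _ ≤ (c * |θ - φ| ^ (2 : ℝ)) ^ (-(1 / 4) : ℝ) :=
          Real.rpow_le_rpow_of_nonpos (by positivity) h4 (by norm_num)
      _ = _ := by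
          rw [Real.mul_rpow hc0.le (by positivity), ← Real.rpow_mul (abs_nonneg _)]; norm_num
  have hint : IntegrableOn (fun θ => |arcsinePoint p q φ - arcsinePoint p q θ| ^ (-(1 / 4) : ℝ))
      (Set.Ioo 0 Real.pi) := by
    refine (hi.const_mul (c ^ (-(1 / 4) : ℝ))).mono' ?_ ?_
    · have := (continuous_arcsinePoint p q).measurable
      exact Measurable.aestronglyMeasurable (by fun_prop)
    · filter_upwards [ae_restrict_mem measurableSet_Ioo] with θ hθ
      rw [Real.norm_of_nonneg (by positivity)]
      exact hbd θ hθ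
  refine ⟨hint, ?_⟩
  calc _ ≤ ∫ θ in Set.Ioo 0 Real.pi, c ^ (-(1 / 4) : ℝ) * |θ - φ| ^ (-(1 / 2) : ℝ) :=
        setIntegral_mono_on hint (hi.const_mul _) measurableSet_Ioo hbd
    _ ≤ _ := by
        rw [integral_const_mul]
        exact mul_le_mul_of_nonneg_left hle (by positivity)

theorem arcsinePoint_ne_ae {p q : ℝ} (hpq : p < q) (x : ℝ) :
    ∀ᵐ θ ∂(volume.restrict (Set.Ioo 0 Real.pi)), arcsinePoint p q θ ≠ x := by
  have hfin : ({θ | arcsinePoint p q θ = x} ∩ Set.Ioo 0 Real.pi).Subsingleton := by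
    rintro θ ⟨h1, h1'⟩ θ' ⟨h2, h2'⟩
    refine Real.injOn_cos ⟨h1'.1.le, h1'.2.le⟩ ⟨h2'.1.le, h2'.2.le⟩ ?_
    have h3 : arcsinePoint p q θ = arcsinePoint p q θ' := h1.trans h2.symm
    unfold arcsinePoint at h3
    have : (q - p) / 2 ≠ 0 := by have : 0 < q - p := by linarith
                                 positivity
    exact mul_left_cancel₀ this (by linarith)
  rw [ae_restrict_iff' measurableSet_Ioo]
  have h0 := hfin.measure_zero volume
  filter_upwards [compl_mem_ae_iff.2 h0] with θ hθ hθ' he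
  exact hθ ⟨he, hθ'⟩

/-- Logarithms are dominated by small powers. -/
theorem abs_log_le_rpow {y : ℝ} (hy : 0 ≤ y) :
    |Real.log y| ≤ 4 * (y ^ (1 / 4 : ℝ) + y ^ (-(1 / 4) : ℝ)) := by
  rcases hy.eq_or_lt with rfl | hy
  · simp [Real.zero_rpow]
  have h2 : Real.log y ≤ y ^ (1 / 4 : ℝ) / (1 / 4) := Real.log_le_rpow_div hy.le (by norm_num)
  have h3 : Real.log y⁻¹ ≤ y⁻¹ ^ (1 / 4 : ℝ) / (1 / 4) :=
    Real.log_le_rpow_div (inv_nonneg.2 hy.le) (by norm_num)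
  rw [Real.log_inv, Real.inv_rpow hy.le, ← Real.rpow_neg hy.le] at h3
  have h4 : 0 < y ^ (1 / 4 : ℝ) := Real.rpow_pos_of_pos hy _
  have h5 : 0 < y ^ (-(1 / 4) : ℝ) := Real.rpow_pos_of_pos hy _
  rw [abs_le]
  constructor <;> linarith

theorem integrableOn_log_abs_sub_arcsinePoint {p q x : ℝ} (hpq : p < q) (hx : x ∈ Set.Icc p q) :
    IntegrableOn (fun θ => Real.log |x - arcsinePoint p q θ|) (Set.Ioo 0 Real.pi) := by
  obtain ⟨K, hK⟩ := exists_integral_abs_sub_arcsinePoint_rpow_le hpq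
  have hm := (continuous_arcsinePoint p q).measurable
  have hi : IntegrableOn (fun _ : ℝ => (q - p) ^ (1 / 4 : ℝ)) (Set.Ioo 0 Real.pi) := by simp
  refine ((hi.add (hK x hx).1).const_mul 4).mono' (Measurable.aestronglyMeasurable (by fun_prop)) ?_
  filter_upwards [ae_restrict_mem measurableSet_Ioo] with θ hθ
  have h := arcsinePoint_mem_Ioo hpq hθ
  have h' : |x - arcsinePoint p q θ| ≤ q - p := by
    rw [abs_le]; constructor <;> linarith [h.1, h.2, hx.1, hx.2]
  rw [Real.norm_eq_abs]
  refine (abs_log_le_rpow (abs_nonneg _)).trans ?_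
  simp only [Pi.add_apply]
  gcongr

/-! ### Fourier coefficients of the logarithmic kernel -/

theorem sin_nat_mul_eq_sum (n : ℕ) (u : ℝ) :
    2 * Real.sin (u / 2) * ∑ k ∈ Finset.range n, Real.cos ((k + 1 / 2) * u) = Real.sin (n * u) := by
  induction n with
  | zero => simp
  | succ n ih =>
    rw [Finset.sum_range_succ, mul_add, ih]
    have h1 : ((n + 1 : ℕ) : ℝ) * u = (n + 1 / 2) * u + u / 2 := by push_cast; ring
    have h2 : (n : ℝ) * u = (n + 1 / 2) * u - u / 2 := by ring
    rw [h1, h2, Real.sin_add, Real.sin_sub]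
    ring

theorem intervalIntegrable_log_two_sin_half (a b : ℝ) :
    IntervalIntegrable (fun u => Real.log (2 * Real.sin (u / 2))) volume a b := by
  apply MeromorphicOn.intervalIntegrable_log
  intro x _
  fun_prop

theorem integral_log_two_sin_half :
    ∫ u in (0 : ℝ)..Real.pi, Real.log (2 * Real.sin (u / 2)) = 0 := by
  have h1 : ∫ u in (0 : ℝ)..Real.pi, Real.log (2 * Real.sin (u / 2)) =
      ∫ u in (0 : ℝ)..Real.pi, (Real.log 2 + Real.log (Real.sin (u / 2))) := by
    rw [intervalIntegral.integral_of_le Real.pi_pos.le, intervalIntegral.integral_of_le Real.pi_pos.le]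
    refine setIntegral_congr_fun measurableSet_Ioc fun u hu => ?_
    have : 0 < Real.sin (u / 2) :=
      Real.sin_pos_of_pos_of_lt_pi (by linarith [hu.1]) (by linarith [hu.2, Real.pi_pos])
    exact Real.log_mul (by norm_num) this.ne'
  have hi : IntervalIntegrable (fun u => Real.log (Real.sin (u / 2))) volume 0 Real.pi := by
    apply MeromorphicOn.intervalIntegrable_log
    intro x _
    fun_prop
  rw [h1, intervalIntegral.integral_add (by simp) hi,
    intervalIntegral.integral_comp_div (fun u => Real.log (Real.sin u)) (by norm_num : (2 : ℝ) ≠ 0)]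
  simp [integral_log_sin_zero_pi_div_two]
  ring

/-- Integration by parts with an explicit antiderivative. Writing `sin (n * u) = A u * W u` replaces
`log A * sin (n * u)` by `A * log A * W`, which is continuous at `0`, so no limit at the singular
endpoint is needed. -/
theorem integral_log_two_sin_half_mul_cos {n : ℕ} (hn : n ≠ 0) :
    ∫ u in (0 : ℝ)..Real.pi, Real.log (2 * Real.sin (u / 2)) * Real.cos (n * u) =
      -(Real.pi / (2 * n)) := by
  have hn' : (n : ℝ) ≠ 0 := Nat.cast_ne_zero.2 hn
  set A : ℝ → ℝ := fun u => 2 * Real.sin (u / 2) with hA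
  set W : ℝ → ℝ := fun u => ∑ k ∈ Finset.range n, Real.cos ((k + 1 / 2) * u) with hW
  -- `c k` is a primitive of `cos (k * u)`. As `2 * cos (u/2) * cos ((k + 1/2) * u) = cos ((k+1) *
  -- u) + cos (k * u)`, the sum `B` is a primitive of `cos (u/2) * W u`. Only `c 0` contributes at
  -- `π`.
  set c : ℕ → ℝ → ℝ := fun k u => if k = 0 then u else Real.sin (k * u) / k with hcdef
  set B : ℝ → ℝ := fun u => ∑ k ∈ Finset.range n, (c (k + 1) u + c k u) / 2 with hB
  have hc : ∀ k u, HasDerivAt (c k) (Real.cos (k * u)) u := by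
    intro k u
    by_cases hk : k = 0
    · subst hk; simpa [hcdef] using hasDerivAt_id' u
    · have hk' : (k : ℝ) ≠ 0 := Nat.cast_ne_zero.2 hk
      have h1 : HasDerivAt (fun u : ℝ => (k : ℝ) * u) k u := by
        simpa using (hasDerivAt_id' u).const_mul (k : ℝ)
      have h2 := h1.sin.div_const (k : ℝ)
      simp only [hcdef, hk, if_false]
      exact h2.congr_deriv (by field_simp)
  have hBd : ∀ u, HasDerivAt B (Real.cos (u / 2) * W u) u := by
    intro u
    have h1 : HasDerivAt B (∑ k ∈ Finset.range n,
        (Real.cos ((k + 1 : ℕ) * u) + Real.cos (k * u)) / 2) u := by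
      exact HasDerivAt.fun_sum fun k _ => ((hc (k + 1) u).add (hc k u)).div_const 2
    refine h1.congr_deriv ?_
    rw [hW, Finset.mul_sum]
    refine Finset.sum_congr rfl fun k _ => ?_
    have h2 : ((k + 1 : ℕ) : ℝ) * u = (k + 1 / 2) * u + u / 2 := by push_cast; ring
    have h3 : (k : ℝ) * u = (k + 1 / 2) * u - u / 2 := by ring
    rw [h2, h3, Real.cos_add, Real.cos_sub]
    ring_nf
  have hAd : ∀ u, HasDerivAt A (Real.cos (u / 2)) u := by
    intro u
    have h2 := (((hasDerivAt_id' u).div_const 2).sin).const_mul 2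
    exact h2.congr_deriv (by ring)
  have hAW : ∀ u, A u * W u = Real.sin (n * u) := sin_nat_mul_eq_sum n
  have hcont : Continuous fun u => A u * Real.log (A u) * W u / n - B u / n := by
    have h1 : Continuous A := continuous_iff_continuousAt.2 fun u => (hAd u).continuousAt
    have h2 : Continuous B := continuous_iff_continuousAt.2 fun u => (hBd u).continuousAt
    have h3 : Continuous W := by rw [hW]; fun_prop
    have h4 : Continuous fun u => A u * Real.log (A u) := Real.continuous_mul_log.comp h1
    fun_prop
  have hder : ∀ u ∈ Set.Ioo 0 Real.pi,
      HasDerivAt (fun u => A u * Real.log (A u) * W u / n - B u / n)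
        (Real.log (A u) * Real.cos (n * u)) u := by
    intro u hu
    have hApos : 0 < A u := mul_pos two_pos (Real.sin_pos_of_pos_of_lt_pi (by linarith [hu.1])
      (by linarith [hu.2, Real.pi_pos]))
    have h1 : HasDerivAt (fun u : ℝ => (n : ℝ) * u) n u := by
      simpa using (hasDerivAt_id' u).const_mul (n : ℝ)
    have h2 := ((((hAd u).log hApos.ne').mul h1.sin).div_const (n : ℝ)).sub ((hBd u).div_const (n : ℝ))
    refine (h2.congr_deriv ?_).congr_of_eventuallyEq (Eventually.of_forall fun v => ?_)
    · rw [← hAW]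
      field_simp
      ring
    · simp only [Pi.sub_apply, Pi.mul_apply]
      rw [← hAW]
      ring
  have hint : IntervalIntegrable (fun u => Real.log (A u) * Real.cos (n * u)) volume 0 Real.pi :=
    (intervalIntegrable_log_two_sin_half 0 Real.pi).mul_continuousOn (by fun_prop)
  rw [intervalIntegral.integral_eq_sub_of_hasDerivAt_of_le Real.pi_pos.le hcont.continuousOn hder hint]
  have hB0 : B 0 = 0 := by
    refine Finset.sum_eq_zero fun k _ => ?_
    simp [hcdef]
  have hA0 : A 0 = 0 := by simp [hA]
  have hWpi : A Real.pi * W Real.pi = 0 := by rw [hAW]; exact Real.sin_nat_mul_pi n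
  have hBpi : B Real.pi = Real.pi / 2 := by
    obtain ⟨j, rfl⟩ := Nat.exists_eq_succ_of_ne_zero hn
    have h0 : ∀ k, c (k + 1) Real.pi = 0 := fun k => by
      simp only [hcdef, Nat.add_eq_zero_iff, one_ne_zero, and_false, if_false,
        Real.sin_nat_mul_pi, zero_div]
    simp only [hB, Finset.sum_range_succ', h0]
    simp [hcdef]
  have e : A Real.pi * Real.log (A Real.pi) * W Real.pi = Real.log (A Real.pi) * (A Real.pi * W Real.pi) := by
    ring
  rw [e, hWpi, hBpi, hB0, hA0]
  field_simp
  ring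

theorem log_two_sin_half_neg (u : ℝ) :
    Real.log (2 * Real.sin (-u / 2)) = Real.log (2 * Real.sin (u / 2)) := by
  rw [neg_div, Real.sin_neg, mul_neg, Real.log_neg_eq_log]

theorem log_two_sin_half_add_two_pi (u : ℝ) :
    Real.log (2 * Real.sin ((u + 2 * Real.pi) / 2)) = Real.log (2 * Real.sin (u / 2)) := by
  have : (u + 2 * Real.pi) / 2 = u / 2 + Real.pi := by ring
  rw [this, Real.sin_add_pi, mul_neg, Real.log_neg_eq_log]

/-- Because `Real.log` ignores signs, `log (2 * sin (u / 2))` is even and `2π`-periodic. Translating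
by `θ` and expanding `cos (n * (u - θ))`, the sine part integrates to zero. -/
theorem integral_neg_pi_pi_log_two_sin_half_mul_cos (n : ℕ) (θ : ℝ) :
    ∫ φ in (-Real.pi)..Real.pi, Real.log (2 * Real.sin ((φ + θ) / 2)) * Real.cos (n * φ) =
      Real.cos (n * θ) *
        (2 * ∫ u in (0 : ℝ)..Real.pi, Real.log (2 * Real.sin (u / 2)) * Real.cos (n * u)) := by
  set l : ℝ → ℝ := fun u => Real.log (2 * Real.sin (u / 2)) with hl
  have hli : ∀ a b, IntervalIntegrable l volume a b := intervalIntegrable_log_two_sin_half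
  have hper : Function.Periodic (fun u => l u * Real.cos (n * (u - θ))) (2 * Real.pi) := by
    intro u
    have h1 : (n : ℝ) * (u + 2 * Real.pi - θ) = n * (u - θ) + n * (2 * Real.pi) := by ring
    simp only [hl]
    rw [log_two_sin_half_add_two_pi, h1, Real.cos_add_nat_mul_two_pi]
  have h1 : ∫ φ in (-Real.pi)..Real.pi, l (φ + θ) * Real.cos (n * φ) =
      ∫ u in (-Real.pi)..Real.pi, l u * Real.cos (n * (u - θ)) := by
    have h2 := intervalIntegral.integral_comp_add_right (a := -Real.pi) (b := Real.pi)
      (fun u => l u * Real.cos (n * (u - θ))) θ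
    have h3 := hper.intervalIntegral_add_eq (-Real.pi + θ) (-Real.pi)
    have e1 : -Real.pi + θ + 2 * Real.pi = Real.pi + θ := by ring
    have e2 : -Real.pi + 2 * Real.pi = Real.pi := by ring
    rw [e1, e2] at h3
    rw [← h3, ← h2]
    simp
  have hc : ∀ a b, IntervalIntegrable (fun u => l u * Real.cos (n * u)) volume a b := fun a b =>
    (hli a b).mul_continuousOn (by fun_prop)
  have hs : ∀ a b, IntervalIntegrable (fun u => l u * Real.sin (n * u)) volume a b := fun a b =>
    (hli a b).mul_continuousOn (by fun_prop)
  have h4 : ∫ u in (-Real.pi)..Real.pi, l u * Real.cos (n * (u - θ)) =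
      Real.cos (n * θ) * (∫ u in (-Real.pi)..Real.pi, l u * Real.cos (n * u)) +
      Real.sin (n * θ) * (∫ u in (-Real.pi)..Real.pi, l u * Real.sin (n * u)) := by
    rw [← intervalIntegral.integral_const_mul, ← intervalIntegral.integral_const_mul,
      ← intervalIntegral.integral_add ((hc _ _).const_mul _) ((hs _ _).const_mul _)]
    refine intervalIntegral.integral_congr fun u _ => ?_
    rw [mul_sub, Real.cos_sub]
    ring
  have h5 : ∫ u in (-Real.pi)..0, l u * Real.cos (n * u) =
      ∫ u in (0 : ℝ)..Real.pi, l u * Real.cos (n * u) := by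
    have := intervalIntegral.integral_comp_neg (a := 0) (b := Real.pi)
      (fun u => l u * Real.cos (n * u))
    simp only [neg_zero] at this
    rw [← this]
    refine intervalIntegral.integral_congr fun u _ => ?_
    simp only [hl]
    rw [log_two_sin_half_neg, mul_neg, Real.cos_neg]
  have h6 : ∫ u in (-Real.pi)..0, l u * Real.sin (n * u) =
      -∫ u in (0 : ℝ)..Real.pi, l u * Real.sin (n * u) := by
    have := intervalIntegral.integral_comp_neg (a := 0) (b := Real.pi)
      (fun u => l u * Real.sin (n * u))
    simp only [neg_zero] at this
    rw [← this, ← intervalIntegral.integral_neg]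
    refine intervalIntegral.integral_congr fun u _ => ?_
    simp only [hl]
    rw [log_two_sin_half_neg, mul_neg, Real.sin_neg]
    ring
  rw [h1, h4, ← intervalIntegral.integral_add_adjacent_intervals (hc _ 0) (hc 0 _),
    ← intervalIntegral.integral_add_adjacent_intervals (hs _ 0) (hs 0 _), h5, h6]
  ring

/-- The kernel splits as `log (2 sin ((φ+θ)/2)) + log (2 sin ((φ-θ)/2)) - log 2`. Reflecting `φ` in
the second term unfolds the integral over `(0, π)` to one over `(-π, π)`. -/
theorem integral_log_cos_sub_cos_mul_cos (n : ℕ) (θ : ℝ) :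
    ∫ φ in Set.Ioo 0 Real.pi, Real.log |Real.cos θ - Real.cos φ| * Real.cos (n * φ) =
      Real.cos (n * θ) *
        (2 * ∫ u in (0 : ℝ)..Real.pi, Real.log (2 * Real.sin (u / 2)) * Real.cos (n * u)) -
      Real.log 2 * ∫ u in (0 : ℝ)..Real.pi, Real.cos (n * u) := by
  set l : ℝ → ℝ := fun u => Real.log (2 * Real.sin (u / 2)) with hl
  have hli : ∀ c a b, IntervalIntegrable (fun u => l (u + c) * Real.cos (n * u)) volume a b := by
    intro c a b
    refine IntervalIntegrable.mul_continuousOn ?_ (by fun_prop)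
    apply MeromorphicOn.intervalIntegrable_log
    intro x _
    fun_prop
  have h1 : ∫ φ in Set.Ioo 0 Real.pi, Real.log |Real.cos θ - Real.cos φ| * Real.cos (n * φ) =
      ∫ φ in (0 : ℝ)..Real.pi, (l (φ + θ) * Real.cos (n * φ) + l (φ + -θ) * Real.cos (n * φ) -
        Real.log 2 * Real.cos (n * φ)) := by
    rw [intervalIntegral.integral_of_le Real.pi_pos.le, integral_Ioc_eq_integral_Ioo]
    refine integral_congr_ae ?_
    filter_upwards [arcsinePoint_ne_ae (by norm_num : (-1 : ℝ) < 1) (Real.cos θ)] with φ hφ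
    have h2 : Real.cos θ - Real.cos φ = 2 * Real.sin ((φ + θ) / 2) * Real.sin ((φ + -θ) / 2) := by
      rw [Real.cos_sub_cos]
      have : (φ + -θ) / 2 = -((θ - φ) / 2) := by ring
      rw [this, Real.sin_neg, add_comm φ]
      ring
    have h3 : Real.cos θ - Real.cos φ ≠ 0 := by
      intro h
      apply hφ
      unfold arcsinePoint
      norm_num
      linarith
    rw [h2] at h3
    have h4 := left_ne_zero_of_mul h3
    have h5 := right_ne_zero_of_mul h3
    rw [Real.log_abs, h2, Real.log_mul h4 h5]
    have h6 : Real.log (2 * Real.sin ((φ + -θ) / 2)) = Real.log 2 + _ :=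
      Real.log_mul (by norm_num) h5
    simp only [hl]
    rw [h6]
    ring
  have h7 : ∫ φ in (0 : ℝ)..Real.pi, l (φ + -θ) * Real.cos (n * φ) =
      ∫ φ in (-Real.pi)..0, l (φ + θ) * Real.cos (n * φ) := by
    have := intervalIntegral.integral_comp_neg (a := 0) (b := Real.pi)
      (fun φ => l (φ + θ) * Real.cos (n * φ))
    simp only [neg_zero] at this
    rw [← this]
    refine intervalIntegral.integral_congr fun u _ => ?_
    simp only [hl]
    have : -u + θ = -(u + -θ) := by ring
    rw [this, log_two_sin_half_neg, mul_neg, Real.cos_neg]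
  have hcc : IntervalIntegrable (fun φ => Real.log 2 * Real.cos (n * φ)) volume 0 Real.pi :=
    Continuous.intervalIntegrable (by fun_prop) _ _
  rw [h1, intervalIntegral.integral_sub ((hli _ _ _).add (hli _ _ _)) hcc,
    intervalIntegral.integral_add (hli _ _ _) (hli _ _ _), h7, add_comm,
    intervalIntegral.integral_add_adjacent_intervals (hli _ _ _) (hli _ _ _),
    integral_neg_pi_pi_log_two_sin_half_mul_cos, intervalIntegral.integral_const_mul]

theorem integral_log_cos_sub_cos (θ : ℝ) :
    ∫ φ in Set.Ioo 0 Real.pi, Real.log |Real.cos θ - Real.cos φ| = -(Real.pi * Real.log 2) := by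
  have := integral_log_cos_sub_cos_mul_cos 0 θ
  simp [integral_log_two_sin_half] at this
  simp [this, mul_comm]

/-- The logarithmic kernel is diagonal in the cosines, with eigenvalue `-π / n`. That this is
nonzero is what makes the law recoverable from its potential. -/
theorem integral_log_cos_sub_cos_mul_cos_of_ne_zero {n : ℕ} (hn : n ≠ 0) (θ : ℝ) :
    ∫ φ in Set.Ioo 0 Real.pi, Real.log |Real.cos θ - Real.cos φ| * Real.cos (n * φ) =
      -(Real.pi / n) * Real.cos (n * θ) := by
  have hn' : (n : ℝ) ≠ 0 := Nat.cast_ne_zero.2 hn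
  rw [integral_log_cos_sub_cos_mul_cos, integral_log_two_sin_half_mul_cos hn,
    intervalIntegral.integral_comp_mul_left (fun x => Real.cos x) hn']
  simp [Real.sin_nat_mul_pi]
  field_simp

/-! ### Logarithmic potential of the Arcsine law and the equalization identity -/

theorem integral_log_abs_sub_arcsinePoint {p q x : ℝ} (hpq : p < q) (hx : x ∈ Set.Icc p q) :
    ∫ θ in Set.Ioo 0 Real.pi, Real.log |x - arcsinePoint p q θ| =
      Real.pi * Real.log ((q - p) / 4) := by
  obtain ⟨φ, -, rfl⟩ := exists_arcsinePoint_eq hpq hx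
  have hb : 0 < q - p := by linarith
  have h1 : ∫ θ in Set.Ioo 0 Real.pi, Real.log |arcsinePoint p q φ - arcsinePoint p q θ| =
      ∫ θ in Set.Ioo 0 Real.pi, (Real.log ((q - p) / 2) +
        Real.log |Real.cos φ - Real.cos θ|) := by
    refine integral_congr_ae ?_
    filter_upwards [arcsinePoint_ne_ae hpq (arcsinePoint p q φ)] with θ hθ
    have h2 : arcsinePoint p q φ - arcsinePoint p q θ =
        (q - p) / 2 * (Real.cos φ - Real.cos θ) := by unfold arcsinePoint; ring
    have h3 : Real.cos φ - Real.cos θ ≠ 0 := by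
      intro h
      rw [h, mul_zero] at h2
      exact hθ (sub_eq_zero.1 h2).symm
    rw [h2, abs_mul, Real.log_mul (by positivity) (abs_ne_zero.2 h3), abs_of_pos (by positivity)]
  have hi : IntegrableOn (fun θ => Real.log |Real.cos φ - Real.cos θ|) (Set.Ioo 0 Real.pi) := by
    have := integrableOn_log_abs_sub_arcsinePoint (p := -1) (q := 1) (x := Real.cos φ)
      (by norm_num) (Real.cos_mem_Icc φ)
    simpa [arcsinePoint] using this
  rw [h1, integral_add (by simp) hi, integral_log_cos_sub_cos]
  have h4 : Real.log ((q - p) / 4) = Real.log ((q - p) / 2) - Real.log 2 := by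
    rw [← Real.log_div (by positivity) (by norm_num)]
    ring_nf
  rw [h4]
  simp [Real.pi_pos.le]
  ring

/-- This is the potential at `0`, outside the interval. The point factors as `((√q + √p) / 2) ^ 2 *
|e^{iθ} + r| ^ 2` with `r = (√q - √p) / (√q + √p) < 1`, and `log |z + r|` has mean zero over the
unit circle. The symmetry `θ ↦ 2π - θ` passes to the half circle. -/
theorem integral_log_arcsinePoint {p q : ℝ} (hp : 0 < p) (hpq : p < q) :
    ∫ θ in Set.Ioo 0 Real.pi, Real.log (arcsinePoint p q θ) =
      2 * Real.pi * Real.log ((√q + √p) / 2) := by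
  set P := √p with hP
  set Q := √q with hQ
  have hP0 : 0 < P := Real.sqrt_pos.2 hp
  have hPQ : P < Q := Real.sqrt_lt_sqrt hp.le hpq
  have hp2 : p = P ^ 2 := (Real.sq_sqrt hp.le).symm
  have hq2 : q = Q ^ 2 := (Real.sq_sqrt (hp.le.trans hpq.le)).symm
  set r := (Q - P) / (Q + P) with hr
  have hr0 : 0 < r := div_pos (by linarith) (by linarith)
  have hr1 : r < 1 := by rw [hr, div_lt_one (by linarith)]; linarith
  have hca := circleAverage_log_norm_sub_const₀ (a := ((-r : ℝ) : ℂ)) (by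
    rw [Complex.norm_real, norm_neg, Real.norm_of_nonneg hr0.le]; exact hr1)
  have hpt : ∀ θ : ℝ, arcsinePoint p q θ =
      ((Q + P) / 2) ^ 2 * ‖circleMap 0 1 θ - ((-r : ℝ) : ℂ)‖ ^ 2 := by
    intro θ
    have h1 : ‖circleMap 0 1 θ - ((-r : ℝ) : ℂ)‖ ^ 2 = 1 + 2 * r * Real.cos θ + r ^ 2 := by
      rw [← Complex.normSq_eq_norm_sq, Complex.normSq_apply]
      simp [circleMap, Complex.exp_ofReal_mul_I_re, Complex.exp_ofReal_mul_I_im]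
      nlinarith [Real.sin_sq_add_cos_sq θ]
    rw [h1, hr, hp2, hq2]
    unfold arcsinePoint
    have : Q + P ≠ 0 := by linarith
    field_simp
    ring
  set F : ℝ → ℝ := fun θ => Real.log ‖circleMap 0 1 θ - ((-r : ℝ) : ℂ)‖ with hF
  have hne : ∀ θ, ‖circleMap 0 1 θ - ((-r : ℝ) : ℂ)‖ ≠ 0 := by
    intro θ h
    rw [norm_eq_zero, sub_eq_zero] at h
    have := congrArg norm h
    rw [norm_circleMap_zero, Complex.norm_real, norm_neg, Real.norm_of_nonneg hr0.le] at this
    simp at this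
    linarith
  have hFc : Continuous F := Continuous.log (by fun_prop) hne
  have hFeq : ∀ θ, Real.log (arcsinePoint p q θ) = 2 * Real.log ((Q + P) / 2) + 2 * F θ := by
    intro θ
    have : (Q + P) / 2 ≠ 0 := by linarith
    rw [hpt, Real.log_mul (by positivity) (pow_ne_zero _ (hne θ)), Real.log_pow, Real.log_pow]
    simp [hF]
  have hsymm : ∀ θ, F (2 * Real.pi - θ) = F θ := by
    intro θ
    have h1 : arcsinePoint p q (2 * Real.pi - θ) = arcsinePoint p q θ := by
      unfold arcsinePoint; rw [Real.cos_two_pi_sub]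
    have := hFeq (2 * Real.pi - θ)
    rw [h1, hFeq] at this
    linarith
  have hhalf : ∫ θ in (0 : ℝ)..Real.pi, F θ = 0 := by
    have h1 : ∫ θ in (0 : ℝ)..2 * Real.pi, F θ = 0 := by
      rw [Real.circleAverage_def, smul_eq_zero] at hca
      rcases hca with h | h
      · simp at h
      · exact h
    have h2 : ∫ θ in Real.pi..2 * Real.pi, F θ = ∫ θ in (0 : ℝ)..Real.pi, F θ := by
      have := intervalIntegral.integral_comp_sub_left (a := 0) (b := Real.pi) F (2 * Real.pi)
      simp only [hsymm, sub_zero] at this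
      rw [this]
      congr 1
      ring
    rw [← intervalIntegral.integral_add_adjacent_intervals (hFc.intervalIntegrable 0 Real.pi)
      (hFc.intervalIntegrable Real.pi (2 * Real.pi)), h2] at h1
    linarith
  rw [← integral_Ioc_eq_integral_Ioo, ← intervalIntegral.integral_of_le Real.pi_pos.le]
  simp only [hFeq]
  rw [intervalIntegral.integral_add (by simp) ((hFc.const_mul 2).intervalIntegrable _ _),
    intervalIntegral.integral_const_mul (2 : ℝ) F, hhalf]
  simp
  ring

theorem acceleratedRate_eq {p q : ℝ} (hp : 0 < p) (hpq : p < q) :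
    acceleratedRate p q = (√q - √p) / (√q + √p) := by
  have h1 : 0 < √p := Real.sqrt_pos.2 hp
  have h2 : 0 < √q := Real.sqrt_pos.2 (hp.trans hpq)
  unfold acceleratedRate
  rw [Real.sqrt_div (hp.trans hpq).le]
  field_simp

theorem acceleratedRate_pos {p q : ℝ} (hp : 0 < p) (hpq : p < q) : 0 < acceleratedRate p q := by
  rw [acceleratedRate_eq hp hpq]
  have h1 : 0 < √p := Real.sqrt_pos.2 hp
  have h2 : √p < √q := Real.sqrt_lt_sqrt hp.le hpq
  exact div_pos (by linarith) (by linarith)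

theorem acceleratedRate_inv (p q : ℝ) : acceleratedRate q⁻¹ p⁻¹ = acceleratedRate p q := by
  unfold acceleratedRate
  rw [inv_div_inv]

theorem ae_mem_arcsinePoint {p q : ℝ} (hpq : p < q) :
    ∀ᵐ θ ∂(volume.restrict (Set.Ioo 0 Real.pi)), arcsinePoint p q θ ∈ Set.Ioo p q := by
  filter_upwards [ae_restrict_mem measurableSet_Ioo] with θ hθ
  exact arcsinePoint_mem_Ioo hpq hθ

theorem log_abs_one_sub_div_ae {p q x : ℝ} (hp : 0 < p) (hpq : p < q) :
    ∀ᵐ θ ∂(volume.restrict (Set.Ioo 0 Real.pi)), Real.log |1 - x / arcsinePoint p q θ| =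
      Real.log |x - arcsinePoint p q θ| - Real.log (arcsinePoint p q θ) := by
  filter_upwards [ae_mem_arcsinePoint hpq, arcsinePoint_ne_ae hpq x] with θ hθ hθ'
  have h0 : 0 < arcsinePoint p q θ := hp.trans hθ.1
  have h1 : |1 - x / arcsinePoint p q θ| = |x - arcsinePoint p q θ| / arcsinePoint p q θ := by
    have h2 : 1 - x / arcsinePoint p q θ = (arcsinePoint p q θ - x) / arcsinePoint p q θ := by
      field_simp
    rw [h2, abs_div, abs_of_pos h0, abs_sub_comm]
  rw [h1, Real.log_div (abs_ne_zero.2 (sub_ne_zero.2 (Ne.symm hθ'))) h0.ne']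

theorem integrableOn_log_arcsinePoint {p q : ℝ} (hp : 0 < p) (hpq : p < q) :
    IntegrableOn (fun θ => Real.log (arcsinePoint p q θ)) (Set.Ioo 0 Real.pi) := by
  refine (ContinuousOn.integrableOn_Icc (a := 0) (b := Real.pi) ?_).mono_set Set.Ioo_subset_Icc_self
  refine (Continuous.log (continuous_arcsinePoint p q) fun θ => ne_of_gt ?_).continuousOn
  unfold arcsinePoint
  nlinarith [Real.neg_one_le_cos θ]

theorem integrableOn_log_abs_one_sub_div {p q x : ℝ} (hp : 0 < p) (hpq : p < q)
    (hx : x ∈ Set.Icc p q) :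
    IntegrableOn (fun θ => Real.log |1 - x / arcsinePoint p q θ|) (Set.Ioo 0 Real.pi) :=
  ((integrableOn_log_abs_sub_arcsinePoint hpq hx).sub (integrableOn_log_arcsinePoint hp hpq)).congr
    ((log_abs_one_sub_div_ae hp hpq).mono fun _ h => h.symm)

/-- Equalization: the potential at `x`, which does not depend on `x ∈ [p, q]`, minus the potential
at `0`. The factorization `q - p = (√q - √p) * (√q + √p)` turns the difference into the accelerated
rate. -/
theorem integral_log_abs_one_sub_div {p q x : ℝ} (hp : 0 < p) (hpq : p < q)
    (hx : x ∈ Set.Icc p q) :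
    ∫ θ in Set.Ioo 0 Real.pi, Real.log |1 - x / arcsinePoint p q θ| =
      Real.pi * Real.log (acceleratedRate p q) := by
  rw [integral_congr_ae (log_abs_one_sub_div_ae hp hpq),
    integral_sub (integrableOn_log_abs_sub_arcsinePoint hpq hx)
      (integrableOn_log_arcsinePoint hp hpq), integral_log_abs_sub_arcsinePoint hpq hx,
    integral_log_arcsinePoint hp hpq, acceleratedRate_eq hp hpq]
  have h1 : 0 < √p := Real.sqrt_pos.2 hp
  have h2 : √p < √q := Real.sqrt_lt_sqrt hp.le hpq
  have h3 : q - p = (√q - √p) * (√q + √p) := by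
    nlinarith [Real.sq_sqrt hp.le, Real.sq_sqrt (hp.trans hpq).le]
  have h4 : √q - √p ≠ 0 := by linarith
  have h5 : √q + √p ≠ 0 := by linarith
  have h6 : Real.log (4 : ℝ) = 2 * Real.log 2 := by
    rw [show (4 : ℝ) = 2 ^ 2 by norm_num, Real.log_pow]; simp
  rw [h3, Real.log_div (mul_ne_zero h4 h5) (by norm_num), Real.log_mul h4 h5, Real.log_div h4 h5,
    Real.log_div h5 (by norm_num), h6]
  ring

/-! ### The Arcsine measure and its uniform moment bounds -/

/-- Change of variables: at `x = arcsinePoint p q θ` the quantity `(q - x) * (x - p)` is the square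
of the Jacobian, so the density cancels it up to `1 / π`. -/
theorem arcsineMeasure_eq_map {p q : ℝ} (hpq : p < q) :
    arcsineMeasure p q =
      ENNReal.ofReal (1 / Real.pi) • (volume.restrict (Set.Ioo 0 Real.pi)).map (arcsinePoint p q) := by
  have hm := (continuous_arcsinePoint p q).measurable
  have hb : 0 < (q - p) / 2 := by linarith
  have hinj : Set.InjOn (arcsinePoint p q) (Set.Ioo 0 Real.pi) := by
    intro θ hθ φ hφ h
    refine Real.injOn_cos ⟨hθ.1.le, hθ.2.le⟩ ⟨hφ.1.le, hφ.2.le⟩ ?_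
    unfold arcsinePoint at h
    exact mul_left_cancel₀ hb.ne' (by linarith)
  have himg : arcsinePoint p q '' Set.Ioo 0 Real.pi = Set.Ioo p q := by
    ext x
    constructor
    · rintro ⟨θ, hθ, rfl⟩
      exact arcsinePoint_mem_Ioo hpq hθ
    · intro hx
      obtain ⟨φ, hφ, rfl⟩ := exists_arcsinePoint_eq hpq (Set.Ioo_subset_Icc_self hx)
      refine ⟨φ, ⟨hφ.1.lt_of_ne ?_, hφ.2.lt_of_ne ?_⟩, rfl⟩
      · rintro rfl
        have := hx.2
        simp only [arcsinePoint, Real.cos_zero] at this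
        linarith
      · rintro rfl
        have := hx.1
        simp only [arcsinePoint, Real.cos_pi] at this
        linarith
  have hder : ∀ θ ∈ Set.Ioo 0 Real.pi, HasDerivWithinAt (arcsinePoint p q)
      ((q - p) / 2 * -Real.sin θ) (Set.Ioo 0 Real.pi) θ := by
    intro θ _
    exact (((Real.hasDerivAt_cos θ).const_mul _).const_add _).hasDerivWithinAt
  ext S hS
  rw [arcsineMeasure, withDensity_apply _ hS, Measure.smul_apply, Measure.map_apply hm hS,
    ← lintegral_indicator hS, ← himg,
    lintegral_image_eq_lintegral_abs_deriv_mul measurableSet_Ioo hder hinj]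
  rw [← lintegral_indicator_one (hm hS), smul_eq_mul, ← lintegral_const_mul _ (by
    exact measurable_const.indicator (hm hS))]
  refine setLIntegral_congr_fun measurableSet_Ioo fun θ hθ => ?_
  have hsin : 0 < Real.sin θ := Real.sin_pos_of_pos_of_lt_pi hθ.1 hθ.2
  by_cases hmem : arcsinePoint p q θ ∈ S
  · have hmem' : θ ∈ arcsinePoint p q ⁻¹' S := hmem
    simp only [Set.indicator_of_mem hmem, Set.indicator_of_mem hmem', Pi.one_apply, mul_one]
    rw [← ENNReal.ofReal_mul (abs_nonneg _)]
    congr 1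
    have h1 : (q - arcsinePoint p q θ) * (arcsinePoint p q θ - p) =
        ((q - p) / 2 * Real.sin θ) ^ 2 := by
      unfold arcsinePoint
      have := Real.sin_sq θ
      rw [mul_pow, this]
      ring
    rw [h1, Real.sqrt_sq (by positivity), mul_neg, abs_neg, abs_of_pos (by positivity)]
    have := Real.pi_pos
    have h2 : q - p ≠ 0 := by linarith
    field_simp
  · have hmem' : θ ∉ arcsinePoint p q ⁻¹' S := hmem
    simp only [Set.indicator_of_notMem hmem, Set.indicator_of_notMem hmem', mul_zero]

theorem integral_arcsineMeasure {p q : ℝ} (hpq : p < q) {g : ℝ → ℝ} (hg : Measurable g) :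
    ∫ x, g x ∂(arcsineMeasure p q) =
      1 / Real.pi * ∫ θ in Set.Ioo 0 Real.pi, g (arcsinePoint p q θ) := by
  have hpi := Real.pi_pos
  rw [arcsineMeasure_eq_map hpq, integral_smul_measure,
    integral_map (continuous_arcsinePoint p q).aemeasurable hg.aestronglyMeasurable,
    ENNReal.toReal_ofReal (by positivity), smul_eq_mul]

theorem integrable_arcsineMeasure {p q : ℝ} (hpq : p < q) {g : ℝ → ℝ} (hg : Measurable g)
    (h : IntegrableOn (fun θ => g (arcsinePoint p q θ)) (Set.Ioo 0 Real.pi)) :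
    Integrable g (arcsineMeasure p q) := by
  rw [arcsineMeasure_eq_map hpq]
  refine Integrable.smul_measure ?_ ENNReal.ofReal_ne_top
  exact (integrable_map_measure hg.aestronglyMeasurable
    (continuous_arcsinePoint p q).aemeasurable).2 h

theorem ae_mem_arcsineMeasure (p q : ℝ) : ∀ᵐ x ∂(arcsineMeasure p q), x ∈ Set.Ioo p q :=
  (withDensity_absolutelyContinuous _ _) (ae_restrict_mem measurableSet_Ioo)

theorem ae_ne_arcsineMeasure (p q x : ℝ) : ∀ᵐ y ∂(arcsineMeasure p q), y ≠ x := by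
  refine (withDensity_absolutelyContinuous _ _) ?_
  exact ae_restrict_of_ae (compl_mem_ae_iff.2 (measure_singleton x))

theorem exp_le_one_add_add_sq_mul_exp_abs (x : ℝ) :
    Real.exp x ≤ 1 + x + x ^ 2 * Real.exp |x| := by
  have h := Complex.norm_exp_sub_sum_le_norm_mul_exp x 2
  have e : Complex.exp x - ∑ m ∈ Finset.range 2, (x : ℂ) ^ m / m.factorial =
      ((Real.exp x - (1 + x) : ℝ) : ℂ) := by
    simp [Finset.sum_range_succ]
  rw [e, Complex.norm_real, Complex.norm_real, Real.norm_eq_abs, Real.norm_eq_abs, sq_abs] at h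
  have := le_abs_self (Real.exp x - (1 + x))
  linarith

theorem exp_mul_le_of_abs_le {s L : ℝ} (hs : |s| ≤ 1 / 8) :
    Real.exp (s * L) ≤ 1 + s * L + 128 * s ^ 2 * Real.exp (|L| / 4) := by
  have h1 := exp_le_one_add_add_sq_mul_exp_abs (s * L)
  have h2 : Real.exp |s * L| ≤ Real.exp (|L| / 8) := by
    apply Real.exp_le_exp.2
    rw [abs_mul]
    nlinarith [abs_nonneg L]
  have h3 : (|L| / 8) ^ 2 / 2 ≤ Real.exp (|L| / 8) := by
    have := Real.quadratic_le_exp_of_nonneg (x := |L| / 8) (by positivity)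
    have : 0 ≤ |L| := abs_nonneg L
    linarith
  -- One factor `exp (|L| / 8)` absorbs `L ^ 2` here and the other absorbs `exp |s * L|`; together
  -- they spend the available moment `exp (|L| / 4)`.
  have h4 : L ^ 2 ≤ 128 * Real.exp (|L| / 8) := by
    rw [div_pow, sq_abs] at h3
    linarith
  have h5 : Real.exp (|L| / 4) = Real.exp (|L| / 8) * Real.exp (|L| / 8) := by
    rw [← Real.exp_add]; ring_nf
  have h6 : (s * L) ^ 2 * Real.exp |s * L| ≤ 128 * s ^ 2 * Real.exp (|L| / 4) := by
    rw [h5, mul_pow]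
    calc s ^ 2 * L ^ 2 * Real.exp |s * L|
        ≤ s ^ 2 * (128 * Real.exp (|L| / 8)) * Real.exp (|L| / 8) := by gcongr
      _ = _ := by ring
  linarith

/-- The error beyond the mean is quadratic in `s`, so after division by a small `s` the exponential
rate is the mean of `L`, for either sign of `s`. -/
theorem integral_exp_mul_le {X : Type*} [MeasurableSpace X] {μ : Measure X} [IsProbabilityMeasure μ]
    {L : X → ℝ} {K s : ℝ} (hL : Integrable L μ) (hexp : Integrable (fun x => Real.exp (|L x| / 4)) μ)
    (hK : ∫ x, Real.exp (|L x| / 4) ∂μ ≤ K) (hs : |s| ≤ 1 / 8) :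
    ∫⁻ x, ENNReal.ofReal (Real.exp (s * L x)) ∂μ ≤
      ENNReal.ofReal (Real.exp (s * ∫ x, L x ∂μ + 128 * s ^ 2 * K)) := by
  have hi : Integrable (fun x => 1 + s * L x + 128 * s ^ 2 * Real.exp (|L x| / 4)) μ :=
    ((integrable_const _).add (hL.const_mul s)).add (hexp.const_mul _)
  calc ∫⁻ x, ENNReal.ofReal (Real.exp (s * L x)) ∂μ
      ≤ ∫⁻ x, ENNReal.ofReal (1 + s * L x + 128 * s ^ 2 * Real.exp (|L x| / 4)) ∂μ :=
        lintegral_mono fun x => ENNReal.ofReal_le_ofReal (exp_mul_le_of_abs_le hs)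
    _ = ENNReal.ofReal (∫ x, (1 + s * L x + 128 * s ^ 2 * Real.exp (|L x| / 4)) ∂μ) :=
        (ofReal_integral_eq_lintegral_ofReal hi
          (ae_of_all _ fun x => (Real.exp_pos _).le.trans (exp_mul_le_of_abs_le hs))).symm
    _ ≤ _ := by
        apply ENNReal.ofReal_le_ofReal
        rw [integral_add (f := fun x => 1 + s * L x) ((integrable_const _).add (hL.const_mul s))
            (hexp.const_mul _),
          integral_add (integrable_const _) (hL.const_mul s), integral_const_mul, integral_const_mul]
        have h1 : 128 * s ^ 2 * ∫ x, Real.exp (|L x| / 4) ∂μ ≤ 128 * s ^ 2 * K := by gcongr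
        have h2 := Real.add_one_le_exp (s * ∫ x, L x ∂μ + 128 * s ^ 2 * K)
        simp only [integral_const, probReal_univ, smul_eq_mul, mul_one]
        linarith

theorem abs_one_sub_div_lt {p q x s : ℝ} (hp : 0 < p) (hx : x ∈ Set.Icc p q) (hs : s ∈ Set.Ioo p q) :
    |1 - x / s| < q / p := by
  have hs0 : 0 < s := hp.trans hs.1
  have h1 : x / s ≤ q / p := div_le_div₀ (hp.le.trans (hx.1.trans hx.2)) hx.2 hp hs.1.le
  have h2 : 0 < x / s := div_pos (hp.trans_le hx.1) hs0
  have h3 : 1 < q / p := by rw [one_lt_div hp]; exact hs.1.trans hs.2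
  rw [abs_lt]
  constructor <;> linarith

/-- For `y = |1 - x / s|`, the integrand is `y ^ (1/4)` or `y ^ (-1/4)`. The first is at most `(q /
p) ^ (1/4)`; the second is controlled by the singular integral that is uniform in `x`. -/
theorem exists_integral_exp_abs_log_le {p q : ℝ} (hp : 0 < p) (hpq : p < q) :
    ∃ K : ℝ, ∀ x ∈ Set.Icc p q,
      Integrable (fun s => Real.exp (|Real.log (|1 - x / s|)| / 4)) (arcsineMeasure p q) ∧
        ∫ s, Real.exp (|Real.log (|1 - x / s|)| / 4) ∂(arcsineMeasure p q) ≤ K := by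
  obtain ⟨K, hK⟩ := exists_integral_abs_sub_arcsinePoint_rpow_le hpq
  have hpi := Real.pi_pos
  have hq : 0 < q := hp.trans hpq
  have hm := (continuous_arcsinePoint p q).measurable
  refine ⟨1 / Real.pi * ((q / p) ^ (1 / 4 : ℝ) * Real.pi + q ^ (1 / 4 : ℝ) * K), fun x hx => ?_⟩
  obtain ⟨hi, hle⟩ := hK x hx
  have hbd : ∀ᵐ θ ∂(volume.restrict (Set.Ioo 0 Real.pi)),
      Real.exp (|Real.log (|1 - x / arcsinePoint p q θ|)| / 4) ≤
        (q / p) ^ (1 / 4 : ℝ) + q ^ (1 / 4 : ℝ) * |x - arcsinePoint p q θ| ^ (-(1 / 4) : ℝ) := by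
    filter_upwards [ae_mem_arcsinePoint hpq, arcsinePoint_ne_ae hpq x] with θ hθ hne
    set s := arcsinePoint p q θ
    have hs0 : 0 < s := hp.trans hθ.1
    have h1 : |1 - x / s| = |x - s| / s := by
      have h2 : 1 - x / s = (s - x) / s := by field_simp
      rw [h2, abs_div, abs_of_pos hs0, abs_sub_comm]
    have hpos : 0 < |x - s| := abs_pos.2 (sub_ne_zero.2 hne.symm)
    have hpos' : 0 < |1 - x / s| := by rw [h1]; positivity
    have h3 : Real.exp (Real.log |1 - x / s| / 4) ≤ (q / p) ^ (1 / 4 : ℝ) := by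
      rw [div_eq_mul_one_div, ← Real.rpow_def_of_pos hpos']
      exact Real.rpow_le_rpow hpos'.le (abs_one_sub_div_lt hp hx hθ).le (by norm_num)
    have h4 : Real.exp (-Real.log |1 - x / s| / 4) ≤
        q ^ (1 / 4 : ℝ) * |x - s| ^ (-(1 / 4) : ℝ) := by
      have : -Real.log |1 - x / s| / 4 = Real.log |1 - x / s| * (-(1 / 4) : ℝ) := by ring
      rw [this, ← Real.rpow_def_of_pos hpos', h1, Real.div_rpow hpos.le hs0.le,
        Real.rpow_neg hs0.le, div_inv_eq_mul, mul_comm]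
      gcongr
      exact hθ.2.le
    rcases abs_cases (Real.log |1 - x / s|) with ⟨h, -⟩ | ⟨h, -⟩ <;> rw [h]
    · exact h3.trans (le_add_of_nonneg_right (by positivity))
    · exact h4.trans (le_add_of_nonneg_left (by positivity))
  have hi' : IntegrableOn (fun θ => (q / p) ^ (1 / 4 : ℝ) +
      q ^ (1 / 4 : ℝ) * |x - arcsinePoint p q θ| ^ (-(1 / 4) : ℝ)) (Set.Ioo 0 Real.pi) :=
    Integrable.add (by simp) (hi.const_mul _)
  have hint : IntegrableOn (fun θ => Real.exp (|Real.log (|1 - x / arcsinePoint p q θ|)| / 4))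
      (Set.Ioo 0 Real.pi) := by
    refine hi'.mono' (Measurable.aestronglyMeasurable (by fun_prop)) ?_
    filter_upwards [hbd] with θ hθ
    rwa [Real.norm_of_nonneg (Real.exp_pos _).le]
  have hgm : Measurable fun s => Real.exp (|Real.log (|1 - x / s|)| / 4) := by fun_prop
  refine ⟨integrable_arcsineMeasure hpq hgm hint, ?_⟩
  rw [integral_arcsineMeasure hpq hgm]
  refine mul_le_mul_of_nonneg_left ?_ (by positivity)
  refine (integral_mono_ae hint hi' hbd).trans ?_
  rw [integral_add (by simp) (hi.const_mul _), integral_const_mul]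
  have : q ^ (1 / 4 : ℝ) * ∫ θ in Set.Ioo 0 Real.pi, |x - arcsinePoint p q θ| ^ (-(1 / 4) : ℝ) ≤
      q ^ (1 / 4 : ℝ) * K := by gcongr
  simp [hpi.le]
  simp at this
  linarith

theorem isProbabilityMeasure_arcsineMeasure {p q : ℝ} (hpq : p < q) :
    IsProbabilityMeasure (arcsineMeasure p q) := by
  have hpi := Real.pi_pos
  constructor
  rw [arcsineMeasure_eq_map hpq, Measure.smul_apply,
    Measure.map_apply (continuous_arcsinePoint p q).measurable MeasurableSet.univ]
  simp only [Set.preimage_univ, Measure.restrict_apply_univ, Real.volume_Ioo, sub_zero, smul_eq_mul]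
  rw [← ENNReal.ofReal_mul (by positivity), one_div_mul_cancel hpi.ne', ENNReal.ofReal_one]

theorem integrable_log_arcsineMeasure {p q x : ℝ} (hp : 0 < p) (hpq : p < q) (hx : x ∈ Set.Icc p q) :
    Integrable (fun s => Real.log |1 - x / s|) (arcsineMeasure p q) :=
  integrable_arcsineMeasure hpq (by fun_prop) (integrableOn_log_abs_one_sub_div hp hpq hx)

theorem integral_log_arcsineMeasure {p q x : ℝ} (hp : 0 < p) (hpq : p < q) (hx : x ∈ Set.Icc p q) :
    ∫ s, Real.log |1 - x / s| ∂(arcsineMeasure p q) = Real.log (acceleratedRate p q) := by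
  have hpi := Real.pi_pos
  rw [integral_arcsineMeasure hpq (by fun_prop), integral_log_abs_one_sub_div hp hpq hx]
  field_simp

theorem exists_lintegral_rpow_arcsineMeasure_le {p q : ℝ} (hp : 0 < p) (hpq : p < q) :
    ∃ K : ℝ, ∀ x ∈ Set.Icc p q, ∀ s : ℝ, |s| ≤ 1 / 8 →
      ∫⁻ b, ‖1 - x / b‖ₑ ^ s ∂(arcsineMeasure p q) ≤
        ENNReal.ofReal (Real.exp (s * Real.log (acceleratedRate p q) + K * s ^ 2)) := by
  have := isProbabilityMeasure_arcsineMeasure hpq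
  obtain ⟨K, hK⟩ := exists_integral_exp_abs_log_le hp hpq
  refine ⟨128 * K, fun x hx s hs => ?_⟩
  have h1 := integral_exp_mul_le (integrable_log_arcsineMeasure hp hpq hx) (hK x hx).1 (hK x hx).2 hs
  rw [integral_log_arcsineMeasure hp hpq hx] at h1
  have e : 128 * K * s ^ 2 = 128 * s ^ 2 * K := by ring
  rw [e]
  refine le_of_eq_of_le (lintegral_congr_ae ?_) h1
  filter_upwards [ae_mem_arcsineMeasure p q, ae_ne_arcsineMeasure p q x] with b hb hne
  have hb0 : 0 < b := hp.trans hb.1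
  have h2 : 1 - x / b ≠ 0 := by
    intro h
    rw [sub_eq_zero, eq_div_iff hb0.ne', one_mul] at h
    exact hne h
  rw [← ofReal_norm, Real.norm_eq_abs, ENNReal.ofReal_rpow_of_pos (abs_pos.2 h2),
    Real.rpow_def_of_pos (abs_pos.2 h2), mul_comm]

/-! ### Growth of the scalar random recursion -/

theorem measurable_recursion {Ω : Type*} {α : ℕ → Ω → ℝ} {z : ℕ → Ω → ℝ} {h : ℝ → ℝ} {c : ℝ}
    (hh : Measurable h) (hz0 : ∀ ω, z 0 ω = c)
    (hz : ∀ n ω, z (n + 1) ω = z n ω * (1 - α n ω * h (z n ω))) (n : ℕ) :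
    Measurable[⨆ i ∈ Set.Iio n, MeasurableSpace.comap (α i) inferInstance] (z n) := by
  induction n with
  | zero =>
    have : z 0 = fun _ => c := funext hz0
    rw [this]
    exact measurable_const
  | succ n ih =>
    have hle : (⨆ i ∈ Set.Iio n, MeasurableSpace.comap (α i) inferInstance) ≤
        ⨆ i ∈ Set.Iio (n + 1), MeasurableSpace.comap (α i) (inferInstance : MeasurableSpace ℝ) :=
      biSup_mono fun i hi => Nat.lt_succ_of_lt hi
    have h1 := ih.mono hle le_rfl
    have h2 : Measurable[⨆ i ∈ Set.Iio (n + 1), MeasurableSpace.comap (α i) inferInstance] (α n) :=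
      (comap_measurable (α n)).mono
        (le_biSup (fun i => MeasurableSpace.comap (α i) inferInstance) (Nat.lt_succ_self n)) le_rfl
    have : z (n + 1) = fun ω => z n ω * (1 - α n ω * h (z n ω)) := funext (hz n)
    rw [this]
    exact h1.mul (measurable_const.sub (h2.mul (hh.comp h1)))

theorem indepFun_recursion {Ω : Type*} [MeasurableSpace Ω] {P : Measure Ω}
    {α : ℕ → Ω → ℝ} {z : ℕ → Ω → ℝ} {h : ℝ → ℝ} {c : ℝ}
    (hα : ∀ n, Measurable (α n)) (hindep : iIndepFun α P)
    (hh : Measurable h) (hz0 : ∀ ω, z 0 ω = c)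
    (hz : ∀ n ω, z (n + 1) ω = z n ω * (1 - α n ω * h (z n ω))) (n : ℕ) :
    IndepFun (z n) (α n) P := by
  have h1 := indep_iSup_of_disjoint (fun i => (hα i).comap_le) hindep.iIndep
    (S := Set.Iio n) (T := {n}) (by simp)
  rw [IndepFun_iff_Indep]
  refine indep_of_indep_of_le_left (indep_of_indep_of_le_right h1 ?_) ?_
  · exact le_biSup (fun i => MeasurableSpace.comap (α i) inferInstance) rfl
  · exact (measurable_recursion hh hz0 hz n).comap_le

/-- Since `α n` is independent of `z n`, it can be integrated out with `z n = y` frozen. The bound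
`ρ` holds at every `y`, so the dependence of the slope on the past costs nothing. -/
theorem lintegral_rpow_recursion_le {Ω : Type*} [MeasurableSpace Ω] {P : Measure Ω}
    [IsProbabilityMeasure P] {ν : Measure ℝ} {α : ℕ → Ω → ℝ} {z : ℕ → Ω → ℝ} {h : ℝ → ℝ}
    {c : ℝ} (hα : ∀ n, Measurable (α n)) (hlaw : ∀ n, P.map (α n) = ν) (hindep : iIndepFun α P)
    (hh : Measurable h) (hz0 : ∀ ω, z 0 ω = c)
    (hz : ∀ n ω, z (n + 1) ω = z n ω * (1 - α n ω * h (z n ω)))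
    {s : ℝ} {ρ : ENNReal} (hρ : ∀ y, ∫⁻ a, ‖1 - a * h y‖ₑ ^ s ∂ν ≤ ρ) (n : ℕ) :
    ∫⁻ ω, ‖z n ω‖ₑ ^ s ∂P ≤ ‖c‖ₑ ^ s * ρ ^ n := by
  have hν : IsProbabilityMeasure ν := hlaw 0 ▸ Measure.isProbabilityMeasure_map (hα 0).aemeasurable
  have hzm : ∀ n, Measurable (z n) := fun n => (measurable_recursion hh hz0 hz n).mono
    (iSup₂_le fun i _ => (hα i).comap_le) le_rfl
  induction n with
  | zero => simp [hz0]
  | succ n ih =>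
    have hind := indepFun_recursion hα hindep hh hz0 hz n
    have hmap := (indepFun_iff_map_prod_eq_prod_map_map (hzm n).aemeasurable
      (hα n).aemeasurable).1 hind
    rw [hlaw] at hmap
    set G : ℝ × ℝ → ENNReal := fun x => ‖x.1‖ₑ ^ s * ‖1 - x.2 * h x.1‖ₑ ^ s with hG
    have hGm : Measurable G := by fun_prop
    calc ∫⁻ ω, ‖z (n + 1) ω‖ₑ ^ s ∂P = ∫⁻ ω, G (z n ω, α n ω) ∂P := by
          refine lintegral_congr fun ω => ?_
          rw [hz, enorm_mul, ENNReal.mul_rpow_of_ne_top enorm_ne_top enorm_ne_top]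
      _ = ∫⁻ x, G x ∂(P.map fun ω => (z n ω, α n ω)) :=
          (lintegral_map hGm ((hzm n).prodMk (hα n))).symm
      _ = ∫⁻ y, ∫⁻ a, G (y, a) ∂ν ∂(P.map (z n)) := by
          rw [hmap, lintegral_prod _ hGm.aemeasurable]
      _ ≤ ∫⁻ y, ‖y‖ₑ ^ s * ρ ∂(P.map (z n)) := by
          refine lintegral_mono fun y => ?_
          simp only [hG]
          rw [lintegral_const_mul _ (by fun_prop)]
          gcongr
          exact hρ y
      _ = (∫⁻ ω, ‖z n ω‖ₑ ^ s ∂P) * ρ := by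
          rw [lintegral_mul_const _ (by fun_prop), lintegral_map (by fun_prop) (hzm n)]
      _ ≤ ‖c‖ₑ ^ s * ρ ^ n * ρ := by gcongr
      _ = _ := by rw [pow_succ, mul_assoc]

/-- A Borel–Cantelli argument: the series of the `W n` has finite expectation, hence converges
almost surely and its terms tend to zero. -/
theorem ae_eventually_lt_one_of_lintegral_le {Ω : Type*} [MeasurableSpace Ω] {P : Measure Ω}
    {W : ℕ → Ω → ENNReal} (hW : ∀ n, Measurable (W n))
    {C q : ENNReal} (hC : C ≠ ⊤) (hq : q < 1) (h : ∀ n, ∫⁻ ω, W n ω ∂P ≤ C * q ^ n) :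
    ∀ᵐ ω ∂P, ∀ᶠ n in atTop, W n ω < 1 := by
  have h1 : ∫⁻ ω, ∑' n, W n ω ∂P ≠ ⊤ := by
    rw [lintegral_tsum fun n => (hW n).aemeasurable]
    refine ne_top_of_le_ne_top ?_ (ENNReal.tsum_le_tsum h)
    rw [ENNReal.tsum_mul_left, ENNReal.tsum_geometric]
    refine ENNReal.mul_ne_top hC (ENNReal.inv_ne_top.2 ?_)
    exact (tsub_pos_of_lt hq).ne'
  filter_upwards [ae_lt_top (Measurable.tsum hW) h1] with ω hω
  exact (ENNReal.tendsto_atTop_zero_of_tsum_ne_top hω.ne).eventually (gt_mem_nhds one_pos)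

theorem eq_map_inv_of_map_inv_eq {ν μ : Measure ℝ} (h : ν.map (fun a => a⁻¹) = μ) :
    ν = μ.map (fun a => a⁻¹) := by
  rw [← h, Measure.map_map measurable_inv measurable_inv]
  simp

theorem ae_eventually_rpow_recursion_lt {Ω : Type*} [MeasurableSpace Ω] {P : Measure Ω}
    [IsProbabilityMeasure P] {ν : Measure ℝ} {α : ℕ → Ω → ℝ} {z : ℕ → Ω → ℝ} {h : ℝ → ℝ}
    {c : ℝ} (hα : ∀ n, Measurable (α n)) (hlaw : ∀ n, P.map (α n) = ν) (hindep : iIndepFun α P)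
    (hh : Measurable h) (hz0 : ∀ ω, z 0 ω = c) (hc : c ≠ 0)
    (hz : ∀ n ω, z (n + 1) ω = z n ω * (1 - α n ω * h (z n ω)))
    {s r r' : ℝ} (hr : r < r')
    (hρ : ∀ y, ∫⁻ a, ‖1 - a * h y‖ₑ ^ s ∂ν ≤ ENNReal.ofReal (Real.exp r)) :
    ∀ᵐ ω ∂P, ∀ᶠ n : ℕ in atTop,
      ‖z n ω‖ₑ ^ s * ENNReal.ofReal (Real.exp (-(n * r'))) < 1 := by
  have hzm : ∀ n, Measurable (z n) := fun n => (measurable_recursion hh hz0 hz n).mono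
    (iSup₂_le fun i _ => (hα i).comap_le) le_rfl
  have hq : ENNReal.ofReal (Real.exp (r - r')) < 1 := by
    rw [ENNReal.ofReal_lt_one, Real.exp_lt_one_iff]
    linarith
  -- A nonzero start matters here: `0 ^ s = ⊤` in `ENNReal` when `s < 0`.
  have hC : ‖c‖ₑ ^ s ≠ ⊤ := by
    simp [ENNReal.rpow_eq_top_iff, hc]
  refine ae_eventually_lt_one_of_lintegral_le (fun n => by fun_prop) hC hq fun n => ?_
  rw [lintegral_mul_const _ (by fun_prop)]
  refine (mul_le_mul_left (lintegral_rpow_recursion_le hα hlaw hindep hh hz0 hz hρ n) _).trans ?_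
  rw [mul_assoc]
  refine mul_le_mul_right (le_of_eq ?_) _
  rw [← ENNReal.ofReal_pow (Real.exp_pos _).le, ← ENNReal.ofReal_pow (Real.exp_pos _).le,
    ← ENNReal.ofReal_mul (by positivity), ← Real.exp_nat_mul, ← Real.exp_nat_mul, ← Real.exp_add]
  ring_nf

theorem lintegral_rpow_le_of_map_inv_eq {m M : ℝ} (hm : 0 < m) (hmM : m < M) {ν : Measure ℝ}
    (hν : ν.map (fun a => a⁻¹) = arcsineMeasure m M) :
    ∃ K : ℝ, ∀ x ∈ Set.Icc m M, ∀ s : ℝ, |s| ≤ 1 / 8 →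
      ∫⁻ a, ‖1 - a * x‖ₑ ^ s ∂ν ≤
        ENNReal.ofReal (Real.exp (s * Real.log (acceleratedRate m M) + K * s ^ 2)) := by
  obtain ⟨K, hK⟩ := exists_lintegral_rpow_arcsineMeasure_le hm hmM
  refine ⟨K, fun x hx s hs => ?_⟩
  rw [eq_map_inv_of_map_inv_eq hν, lintegral_map (by fun_prop) measurable_inv]
  simpa [div_eq_inv_mul] using hK x hx s hs

theorem ae_eventually_exp_lt_recursion {Ω : Type*} [MeasurableSpace Ω] {P : Measure Ω}
    [IsProbabilityMeasure P] {m M : ℝ} (hm : 0 < m) (hmM : m < M) {ν : Measure ℝ}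
    (hν : ν.map (fun a => a⁻¹) = arcsineMeasure m M) {α : ℕ → Ω → ℝ} {z : ℕ → Ω → ℝ} {h : ℝ → ℝ}
    {c : ℝ} (hα : ∀ n, Measurable (α n)) (hlaw : ∀ n, P.map (α n) = ν) (hindep : iIndepFun α P)
    (hh : Measurable h) (hhm : ∀ y, h y ∈ Set.Icc m M) (hz0 : ∀ ω, z 0 ω = c) (hc : c ≠ 0)
    (hz : ∀ n ω, z (n + 1) ω = z n ω * (1 - α n ω * h (z n ω))) {ε : ℝ} (hε : 0 < ε) :
    ∀ᵐ ω ∂P, ∀ᶠ n : ℕ in atTop,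
      Real.exp (n * (Real.log (acceleratedRate m M) - ε)) < |z n ω| ∧
        |z n ω| < Real.exp (n * (Real.log (acceleratedRate m M) + ε)) := by
  obtain ⟨K, hK⟩ := lintegral_rpow_le_of_map_inv_eq hm hmM hν
  set l := Real.log (acceleratedRate m M)
  -- The order `σ` is small enough that the quadratic error, divided by `σ`, stays below `ε`. The
  -- order `σ` gives the upper bound and `-σ` the lower one.
  obtain ⟨σ, hσ0, hσ8, hσK⟩ : ∃ σ : ℝ, 0 < σ ∧ σ ≤ 1 / 8 ∧ K * σ < ε := by
    refine ⟨min (1 / 8) (ε / (|K| + 1)), by positivity, min_le_left _ _, ?_⟩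
    have h1 : min (1 / 8) (ε / (|K| + 1)) ≤ ε / (|K| + 1) := min_le_right _ _
    have h2 : 0 < min (1 / 8) (ε / (|K| + 1)) := by positivity
    rw [le_div_iff₀ (by positivity)] at h1
    have h3 := le_abs_self K
    nlinarith
  have hKσ : K * σ ^ 2 < σ * ε := by nlinarith
  have hup := ae_eventually_rpow_recursion_lt hα hlaw hindep hh hz0 hc hz
    (r := σ * l + K * σ ^ 2) (r' := σ * (l + ε)) (by linarith)
    (fun y => hK (h y) (hhm y) σ (by rwa [abs_of_pos hσ0]))
  have hlo := ae_eventually_rpow_recursion_lt hα hlaw hindep hh hz0 hc hz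
    (r := -σ * l + K * (-σ) ^ 2) (r' := -σ * (l - ε)) (by rw [neg_sq]; linarith)
    (fun y => hK (h y) (hhm y) (-σ) (by rwa [abs_neg, abs_of_pos hσ0]))
  filter_upwards [hup, hlo] with ω h1 h2
  filter_upwards [h1, h2] with n h1 h2
  -- The negative moment excludes zero, where it would be `⊤`.
  have hne : z n ω ≠ 0 := by
    intro h0
    rw [h0, enorm_zero, ENNReal.zero_rpow_of_neg (by linarith), ENNReal.top_mul] at h2
    · exact not_top_lt h2
    · simp [Real.exp_pos]
  have hpos : 0 < |z n ω| := abs_pos.2 hne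
  have key : ∀ s r : ℝ, ‖z n ω‖ₑ ^ s * ENNReal.ofReal (Real.exp (-(n * r))) < 1 →
      s * Real.log |z n ω| < n * r := by
    intro s r hs
    rw [← ofReal_norm, Real.norm_eq_abs, ENNReal.ofReal_rpow_of_pos hpos,
      ← ENNReal.ofReal_mul (by positivity), Real.rpow_def_of_pos hpos, ← Real.exp_add,
      ENNReal.ofReal_lt_one, Real.exp_lt_one_iff] at hs
    linarith
  have k1 := key _ _ h1
  have k2 := key _ _ h2
  constructor
  · rw [← Real.lt_log_iff_exp_lt hpos]
    nlinarith
  · rw [← Real.log_lt_iff_lt_exp hpos]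
    nlinarith

theorem tendsto_rpow_one_div_of_exp_bounds {u : ℕ → ℝ} {l C : ℝ} (hC : 0 < C)
    (h : ∀ ε > 0, ∀ᶠ n : ℕ in atTop,
      Real.exp (n * (l - ε)) / C ≤ u n ∧ u n ≤ C * Real.exp (n * (l + ε))) :
    Tendsto (fun n : ℕ => u n ^ (1 / (n : ℝ))) atTop (𝓝 (Real.exp l)) := by
  have hlog : Tendsto (fun n : ℕ => Real.log (u n) * (1 / (n : ℝ))) atTop (𝓝 l) := by
    rw [Metric.tendsto_nhds]
    intro ε hε
    have hCn : Tendsto (fun n : ℕ => |Real.log C| / (n : ℝ)) atTop (𝓝 0) :=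
      tendsto_const_div_atTop_nhds_zero_nat _
    filter_upwards [h (ε / 2) (by positivity), hCn.eventually (gt_mem_nhds (by positivity : 0 < ε / 2)),
      eventually_gt_atTop 0] with n hn hCn hn0
    have hn0' : (0 : ℝ) < n := Nat.cast_pos.2 hn0
    have hu : 0 < u n := (by positivity : (0 : ℝ) < Real.exp (n * (l - ε / 2)) / C).trans_le hn.1
    have h1 := Real.log_le_log (by positivity) hn.1
    have h2 := Real.log_le_log hu hn.2
    rw [Real.log_div (Real.exp_pos _).ne' hC.ne', Real.log_exp] at h1
    rw [Real.log_mul hC.ne' (Real.exp_pos _).ne', Real.log_exp] at h2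
    rw [div_lt_iff₀ hn0'] at hCn
    have h3 := abs_lt.1 hCn
    rw [Real.dist_eq, mul_one_div, abs_lt]
    constructor
    · rw [lt_sub_iff_add_lt, lt_div_iff₀ hn0']
      linarith
    · rw [sub_lt_iff_lt_add, div_lt_iff₀ hn0']
      linarith
  refine ((Real.continuous_exp.tendsto l).comp hlog).congr' ?_
  filter_upwards [h 1 one_pos] with n hn
  have hu : 0 < u n := (by positivity : (0 : ℝ) < Real.exp (n * (l - 1)) / C).trans_le hn.1
  rw [Function.comp_apply, Real.rpow_def_of_pos hu]

/-! ### Separable objectives in coordinates -/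

theorem sum_mulVec_sq_of_mem_orthogonalGroup {d : ℕ} {U : Matrix (Fin d) (Fin d) ℝ}
    (hU : U ∈ Matrix.orthogonalGroup (Fin d) ℝ) (x : EuclideanSpace ℝ (Fin d)) :
    ∑ i, (U.mulVec x.ofLp i) ^ 2 = ‖x‖ ^ 2 := by
  have h1 : U.transpose * U = 1 := (Matrix.mem_orthogonalGroup_iff' (Fin d) ℝ).1 hU
  have h2 : ∑ i, (U.mulVec x.ofLp i) ^ 2 = dotProduct (U.mulVec x.ofLp) (U.mulVec x.ofLp) := by
    simp [dotProduct, sq]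
  rw [h2, Matrix.dotProduct_mulVec, Matrix.vecMul_mulVec, ← Matrix.dotProduct_mulVec, h1,
    Matrix.one_mulVec, EuclideanSpace.norm_sq_eq]
  simp [dotProduct, sq]

/-- Along a row of `U`, `f` is a translate of `g i` plus a constant, so `g i` inherits
differentiability and its derivative is the corresponding gradient coordinate. The slope of that
derivative from its zero at the minimizer is at least `m` by strong convexity and at most `M` by the
Lipschitz bound. -/
theorem exists_coordinate_secant_slopes {d : ℕ} {m M : ℝ} (hmM : m < M)
    {f : EuclideanSpace ℝ (Fin d) → ℝ} {xstar : EuclideanSpace ℝ (Fin d)}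
    (hsep : IsSeparableFun f) (hsc : StrongConvexOn Set.univ m f) (hsm : IsSmoothFun M f)
    (hmin : IsMinOn f Set.univ xstar) :
    ∃ U ∈ Matrix.orthogonalGroup (Fin d) ℝ, ∃ h : Fin d → ℝ → ℝ,
      (∀ i, Measurable (h i)) ∧ (∀ i y, h i y ∈ Set.Icc m M) ∧
      ∀ x i, U.mulVec (gradient f x).ofLp i =
        h i (U.mulVec (x - xstar).ofLp i) * U.mulVec (x - xstar).ofLp i := by
  obtain ⟨U, hU, g, hg⟩ := hsep
  obtain ⟨hd, hlip⟩ := hsm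
  have hUU : U * U.transpose = 1 := (Matrix.mem_orthogonalGroup_iff (Fin d) ℝ).1 hU
  set e : Fin d → EuclideanSpace ℝ (Fin d) := fun i => WithLp.toLp 2 (U i) with he
  have hinner : ∀ i v, inner ℝ v (e i) = U.mulVec v.ofLp i := by
    intro i v
    simp [he, PiLp.inner_apply, Matrix.mulVec, dotProduct]
  have hce : ∀ k i, U.mulVec (e i).ofLp k = if k = i then 1 else 0 := by
    intro k i
    have := congrFun (congrFun hUU k) i
    rw [Matrix.one_apply, Matrix.mul_apply] at this
    rw [← this]
    simp [he, Matrix.mulVec, dotProduct]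
  have hen : ∀ i, ‖e i‖ = 1 := by
    intro i
    have h1 : ‖e i‖ ^ 2 = 1 := by
      rw [← real_inner_self_eq_norm_sq, hinner, hce]; simp
    exact (pow_eq_one_iff_of_nonneg (norm_nonneg _) two_ne_zero).1 h1
  have hline : ∀ x i t, f (x + t • e i) = g i (U.mulVec x.ofLp i + t) +
      (f x - g i (U.mulVec x.ofLp i)) := by
    intro x i t
    rw [hg, hg, ← Finset.add_sum_erase _ _ (Finset.mem_univ i),
      ← Finset.add_sum_erase _ _ (Finset.mem_univ i)]
    have h1 : ∀ k, U.mulVec (x + t • e i).ofLp k =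
        U.mulVec x.ofLp k + t * if k = i then 1 else 0 := by
      intro k
      rw [← hce, WithLp.ofLp_add, WithLp.ofLp_smul, Matrix.mulVec_add, Matrix.mulVec_smul]
      rfl
    have h2 : ∑ k ∈ Finset.univ.erase i, g k (U.mulVec (x + t • e i).ofLp k) =
        ∑ k ∈ Finset.univ.erase i, g k (U.mulVec x.ofLp k) := by
      refine Finset.sum_congr rfl fun k hk => ?_
      rw [h1, if_neg (Finset.ne_of_mem_erase hk), mul_zero, add_zero]
    rw [h2, h1, if_pos rfl, mul_one]
    ring
  have hfd : ∀ x i t, HasDerivAt (fun t : ℝ => f (x + t • e i))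
      (U.mulVec (gradient f (x + t • e i)).ofLp i) t := by
    intro x i t
    have h1 := (hd (x + t • e i)).hasGradientAt.hasFDerivAt
    have h2 : HasDerivAt (fun t : ℝ => x + t • e i) (e i) t := by
      simpa using ((hasDerivAt_id' t).smul_const (e i)).const_add x
    have h3 := h1.comp_hasDerivAt t h2
    rw [InnerProductSpace.toDual_apply_apply, hinner] at h3
    exact h3
  have hgd : ∀ x i t, deriv (g i) (U.mulVec x.ofLp i + t) =
      U.mulVec (gradient f (x + t • e i)).ofLp i := by
    intro x i t
    have h1 := hfd x i t
    simp only [hline] at h1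
    have h2 : HasDerivAt (fun t => g i (U.mulVec x.ofLp i + t))
        (U.mulVec (gradient f (x + t • e i)).ofLp i) t := by
      simpa using h1.sub_const (f x - g i (U.mulVec x.ofLp i))
    have h3 := h2.deriv
    rwa [deriv_comp_const_add] at h3
  have hgrad0 : gradient f xstar = 0 := by
    have h1 : IsLocalMin f xstar := hmin.isLocalMin univ_mem
    rw [gradient, h1.fderiv_eq_zero, map_zero]
  set c : Fin d → ℝ := fun i => U.mulVec xstar.ofLp i with hc
  have hG0 : ∀ i, deriv (g i) (c i) = 0 := by
    intro i
    have := hgd xstar i 0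
    simpa [hgrad0] using this
  have hup : ∀ i y, |deriv (g i) (c i + y)| ≤ M * |y| := by
    intro i y
    rw [hgd, ← hinner]
    refine (abs_real_inner_le_norm _ _).trans ?_
    have := hlip (xstar + y • e i) xstar
    rw [hgrad0, sub_zero, add_sub_cancel_left, norm_smul, hen, mul_one, Real.norm_eq_abs] at this
    rwa [hen, mul_one]
  -- This is the derivative of the convex function `f - m / 2 * ‖·‖ ^ 2` along the line through the
  -- minimizer in direction `e i`.
  have hmono : ∀ i, Monotone fun t => deriv (g i) (c i + t) - m * (c i + t) := by
    intro i
    have h1 := strongConvexOn_iff_convex.1 hsc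
    have h2 : ConvexOn ℝ Set.univ fun t : ℝ =>
        f (xstar + t • e i) - m / 2 * ‖xstar + t • e i‖ ^ 2 := by
      have := h1.comp_affineMap (AffineMap.lineMap xstar (xstar + e i))
      simpa [Function.comp_def, AffineMap.lineMap_apply, add_comm] using this
    have h3 : ∀ t : ℝ, HasDerivAt (fun t : ℝ =>
        f (xstar + t • e i) - m / 2 * ‖xstar + t • e i‖ ^ 2)
        (deriv (g i) (c i + t) - m * (c i + t)) t := by
      intro t
      have h4 : HasDerivAt (fun t : ℝ => xstar + t • e i) (e i) t := by
        simpa using ((hasDerivAt_id' t).smul_const (e i)).const_add xstar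
      have h5 := (h4.norm_sq).const_mul (m / 2)
      have h6 := (hfd xstar i t).sub h5
      rw [← hgd] at h6
      refine h6.congr_deriv ?_
      rw [inner_add_left, inner_smul_left, real_inner_self_eq_norm_sq, hen, hinner]
      simp only [hc]
      simp
      ring
    have h7 := h2.monotoneOn_deriv fun t _ => (h3 t).differentiableAt
    intro s t hst
    have h8 := h7 (Set.mem_univ s) (Set.mem_univ t) hst
    rwa [(h3 s).deriv, (h3 t).deriv] at h8
  -- The value at `y = 0` is multiplied by `0`; `m` is chosen only to keep the slope in `[m, M]`.
  refine ⟨U, hU, fun i y => if y = 0 then m else deriv (g i) (c i + y) / y, fun i => ?_,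
    fun i y => ?_, fun x i => ?_⟩
  · refine Measurable.ite (measurableSet_singleton 0) measurable_const ?_
    exact ((measurable_deriv (g i)).comp (measurable_const_add _)).div measurable_id
  · by_cases hy : y = 0
    · simp [hy, hmM.le]
    · simp only [hy, if_false]
      have h1 := hup i y
      rcases lt_or_gt_of_ne hy with hy' | hy'
      · have h2 := hmono i hy'.le
        simp only [add_zero, hG0] at h2
        rw [abs_of_neg hy'] at h1
        have h3 := abs_le.1 h1
        rw [Set.mem_Icc, le_div_iff_of_neg hy', div_le_iff_of_neg hy']
        constructor <;> linarith
      · have h2 := hmono i hy'.le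
        simp only [add_zero, hG0] at h2
        rw [abs_of_pos hy'] at h1
        have h3 := abs_le.1 h1
        rw [Set.mem_Icc, le_div_iff₀ hy', div_le_iff₀ hy']
        constructor <;> linarith
  · have h1 : U.mulVec (x - xstar).ofLp i = U.mulVec x.ofLp i - c i := by
      rw [WithLp.ofLp_sub, Matrix.mulVec_sub]; rfl
    have h2 := hgd x i 0
    rw [zero_smul, add_zero, add_zero] at h2
    rw [h1, ← h2]
    by_cases hy : U.mulVec x.ofLp i - c i = 0
    · simp only [hy, if_true, mul_zero]
      rw [sub_eq_zero.1 hy, hG0]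
    · simp only [hy, if_false]
      rw [add_sub_cancel, div_mul_cancel₀ _ hy]

theorem measurable_gdIterate {d : ℕ} {M : ℝ} {f : EuclideanSpace ℝ (Fin d) → ℝ}
    (hsm : IsSmoothFun M f) (x₀ : EuclideanSpace ℝ (Fin d)) {Ω : Type*} [MeasurableSpace Ω]
    {α : ℕ → Ω → ℝ} (hα : ∀ n, Measurable (α n)) (n : ℕ) :
    Measurable fun ω => gdIterate f (fun t => α t ω) x₀ n := by
  have hg : Measurable (gradient f) := by
    refine (LipschitzWith.of_dist_le' (K := M) fun x y => ?_).continuous.measurable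
    rw [dist_eq_norm, dist_eq_norm]
    exact hsm.2 x y
  induction n with
  | zero => exact measurable_const
  | succ n ih => exact ih.sub ((hα n).smul (hg.comp ih))

theorem measurable_gdRate {d : ℕ} {M : ℝ} {f : EuclideanSpace ℝ (Fin d) → ℝ}
    (hsm : IsSmoothFun M f) (xstar x₀ : EuclideanSpace ℝ (Fin d)) {Ω : Type*} [MeasurableSpace Ω]
    {α : ℕ → Ω → ℝ} (hα : ∀ n, Measurable (α n)) (n : ℕ) :
    Measurable fun ω => gdRate f xstar x₀ (fun t => α t ω) n := by
  have := measurable_gdIterate hsm x₀ hα n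
  unfold gdRate
  fun_prop

theorem gdRate_nonneg {d : ℕ} (f : EuclideanSpace ℝ (Fin d) → ℝ)
    (xstar x₀ : EuclideanSpace ℝ (Fin d)) (a : ℕ → ℝ) (n : ℕ) : 0 ≤ gdRate f xstar x₀ a n := by
  unfold gdRate; positivity

/-- Each coordinate of the error, in the separating basis, follows a scalar recursion. -/
theorem exists_coordinate_recursion {d : ℕ} {m M : ℝ} (hmM : m < M)
    {f : EuclideanSpace ℝ (Fin d) → ℝ} {xstar : EuclideanSpace ℝ (Fin d)}
    (hsep : IsSeparableFun f) (hsc : StrongConvexOn Set.univ m f) (hsm : IsSmoothFun M f)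
    (hmin : IsMinOn f Set.univ xstar) (x₀ : EuclideanSpace ℝ (Fin d)) :
    ∃ (h : Fin d → ℝ → ℝ) (z : Fin d → (ℕ → ℝ) → ℕ → ℝ),
      (∀ i, Measurable (h i)) ∧ (∀ i y, h i y ∈ Set.Icc m M) ∧ (∀ i a b, z i a 0 = z i b 0) ∧
      (∀ i a n, z i a (n + 1) = z i a n * (1 - a n * h i (z i a n))) ∧
      ∀ a n, ∑ i, z i a n ^ 2 = ‖gdIterate f a x₀ n - xstar‖ ^ 2 := by
  obtain ⟨U, hU, h, hh, hhm, hgrad⟩ := exists_coordinate_secant_slopes hmM hsep hsc hsm hmin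
  refine ⟨h, fun i a n => U.mulVec (gdIterate f a x₀ n - xstar).ofLp i, hh, hhm,
    fun i a b => rfl, fun i a n => ?_, fun a n => sum_mulVec_sq_of_mem_orthogonalGroup hU _⟩
  have h1 : gdIterate f a x₀ (n + 1) - xstar =
      (gdIterate f a x₀ n - xstar) - a n • gradient f (gdIterate f a x₀ n) := by
    rw [gdIterate]; abel
  simp only [h1]
  have h2 := hgrad (gdIterate f a x₀ n) i
  generalize gdIterate f a x₀ n - xstar = v at h2 ⊢
  rw [WithLp.ofLp_sub, WithLp.ofLp_smul, Matrix.mulVec_sub, Matrix.mulVec_smul,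
    Pi.sub_apply, Pi.smul_apply, h2, smul_eq_mul]
  ring

/-! ### Convergence under Arcsine inverse stepsizes -/

/-- Every coordinate factor is at most `M / m` in absolute value. This deterministic bound is the
dominating constant for convergence in `L¹`. -/
theorem gdRate_le_of_inv_mem {d : ℕ} {m M : ℝ} (hm : 0 < m) (hmM : m < M)
    {f : EuclideanSpace ℝ (Fin d) → ℝ} {xstar x₀ : EuclideanSpace ℝ (Fin d)}
    (hsep : IsSeparableFun f) (hsc : StrongConvexOn Set.univ m f) (hsm : IsSmoothFun M f)
    (hmin : IsMinOn f Set.univ xstar) (hx₀ : x₀ ≠ xstar) {a : ℕ → ℝ}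
    (ha : ∀ n, (a n)⁻¹ ∈ Set.Ioo m M) (n : ℕ) : gdRate f xstar x₀ a n ≤ M / m := by
  obtain ⟨h, z, -, hhm, -, hz, hsum⟩ := exists_coordinate_recursion hmM hsep hsc hsm hmin x₀
  have hκ : 1 < M / m := (one_lt_div hm).2 hmM
  have hstep : ∀ i n, z i a n ^ 2 ≤ ((M / m) ^ n) ^ 2 * z i a 0 ^ 2 := by
    intro i n
    induction n with
    | zero => simp
    | succ n ih =>
      have h1 := (abs_one_sub_div_lt hm (hhm i (z i a n)) (ha n)).le
      rw [div_eq_mul_inv, inv_inv, mul_comm] at h1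
      rw [hz, mul_pow, pow_succ (M / m), mul_pow]
      have h2 : (1 - a n * h i (z i a n)) ^ 2 ≤ (M / m) ^ 2 := by
        rw [← sq_abs]; gcongr
      calc _ ≤ ((M / m) ^ n) ^ 2 * z i a 0 ^ 2 * (M / m) ^ 2 := by gcongr
        _ = _ := by ring
  have hN : 0 < ‖x₀ - xstar‖ := norm_pos_iff.2 (sub_ne_zero.2 hx₀)
  have hle : ‖gdIterate f a x₀ n - xstar‖ ≤ (M / m) ^ n * ‖x₀ - xstar‖ := by
    refine le_of_sq_le_sq ?_ (by positivity)
    have h0 := hsum a 0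
    rw [gdIterate] at h0
    rw [mul_pow, ← hsum, ← h0, Finset.mul_sum]
    exact Finset.sum_le_sum fun i _ => hstep i n
  rcases Nat.eq_zero_or_pos n with rfl | hn
  · simp [gdRate, hκ.le]
  have h3 : ‖gdIterate f a x₀ n - xstar‖ / ‖x₀ - xstar‖ ≤ (M / m) ^ n := by
    rwa [div_le_iff₀ hN]
  unfold gdRate
  calc _ ≤ ((M / m) ^ n) ^ (1 / (n : ℝ)) := by gcongr
    _ = M / m := by
      rw [one_div, Real.pow_rpow_inv_natCast (by positivity) hn.ne']

theorem ae_tendsto_gdRate {d : ℕ} {m M : ℝ} (hm : 0 < m) (hmM : m < M) {Ω : Type*}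
    [MeasurableSpace Ω] {P : Measure Ω} [IsProbabilityMeasure P] {ν : Measure ℝ}
    {α : ℕ → Ω → ℝ} (hα : ∀ n, Measurable (α n)) (hlaw : ∀ n, P.map (α n) = ν)
    (hindep : iIndepFun α P) (hν : ν.map (fun a => a⁻¹) = arcsineMeasure m M)
    {f : EuclideanSpace ℝ (Fin d) → ℝ} {xstar x₀ : EuclideanSpace ℝ (Fin d)}
    (hsep : IsSeparableFun f) (hsc : StrongConvexOn Set.univ m f) (hsm : IsSmoothFun M f)
    (hmin : IsMinOn f Set.univ xstar) (hx₀ : x₀ ≠ xstar) :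
    ∀ᵐ ω ∂P, Tendsto (fun n => gdRate f xstar x₀ (fun t => α t ω) n) atTop
      (𝓝 (acceleratedRate m M)) := by
  obtain ⟨h, z, hh, hhm, hz0, hz, hsum⟩ := exists_coordinate_recursion hmM hsep hsc hsm hmin x₀
  set l := Real.log (acceleratedRate m M) with hl
  set c : Fin d → ℝ := fun i => z i 0 0 with hc
  have hN : 0 < ‖x₀ - xstar‖ := norm_pos_iff.2 (sub_ne_zero.2 hx₀)
  have hzc : ∀ i a, z i a 0 = c i := fun i a => hz0 i a 0
  obtain ⟨i₀, hi₀⟩ : ∃ i, c i ≠ 0 := by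
    by_contra! hcon
    have h0 := hsum 0 0
    rw [gdIterate, Finset.sum_eq_zero fun i _ => by rw [hzc, hcon]; simp] at h0
    exact (pow_pos hN 2).ne h0
  have hzero : ∀ i, c i = 0 → ∀ a n, z i a n = 0 := by
    intro i hi a n
    induction n with
    | zero => rw [hzc, hi]
    | succ n ih => rw [hz, ih, zero_mul]
  -- The tolerances `1 / (k + 1)` form a countable family, so one null set serves them all.
  have hae : ∀ᵐ ω ∂P, ∀ (k : ℕ) (i : Fin d), c i ≠ 0 → ∀ᶠ n : ℕ in atTop,
      Real.exp (n * (l - 1 / (k + 1))) < |z i (fun t => α t ω) n| ∧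
        |z i (fun t => α t ω) n| < Real.exp (n * (l + 1 / (k + 1))) := by
    rw [ae_all_iff]; intro k
    rw [ae_all_iff]; intro i
    by_cases hi : c i = 0
    · simp [hi]
    have := ae_eventually_exp_lt_recursion hm hmM hν hα hlaw hindep
      (z := fun n ω => z i (fun t => α t ω) n) (hh i) (hhm i) (fun ω => hzc i _) hi
      (fun n ω => hz i _ n) (ε := 1 / (k + 1)) (by positivity)
    filter_upwards [this] with ω hω _
    exact hω
  filter_upwards [hae] with ω hω
  rw [← Real.exp_log (acceleratedRate_pos hm hmM), ← hl]
  -- One constant for both sides: the first summand absorbs the number of coordinates in the upper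
  -- bound, the second the normalization in the lower bound. The `n`-th root removes it.
  have hC : 0 < d / ‖x₀ - xstar‖ + ‖x₀ - xstar‖ := by positivity
  refine tendsto_rpow_one_div_of_exp_bounds hC fun ε hε => ?_
  obtain ⟨k, hk⟩ := exists_nat_one_div_lt hε
  have hall : ∀ᶠ n : ℕ in atTop, ∀ i, c i ≠ 0 →
      Real.exp (n * (l - 1 / (k + 1))) < |z i (fun t => α t ω) n| ∧
        |z i (fun t => α t ω) n| < Real.exp (n * (l + 1 / (k + 1))) := by
    rw [eventually_all]
    intro i
    by_cases hi : c i = 0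
    · simp [hi]
    · filter_upwards [hω k i hi] with n hn _ using hn
  filter_upwards [hall] with n hn
  set y := ‖gdIterate f (fun t => α t ω) x₀ n - xstar‖
  have hs := hsum (fun t => α t ω) n
  have hexp1 : Real.exp (n * (l - ε)) ≤ Real.exp (n * (l - 1 / (k + 1))) := by gcongr
  have hexp2 : Real.exp (n * (l + 1 / (k + 1))) ≤ Real.exp (n * (l + ε)) := by gcongr
  constructor
  · have h1 : |z i₀ (fun t => α t ω) n| ≤ y := by
      refine abs_le_of_sq_le_sq ?_ (norm_nonneg _)
      rw [← hs]
      exact Finset.single_le_sum (f := fun i => z i (fun t => α t ω) n ^ 2)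
        (fun i _ => sq_nonneg _) (Finset.mem_univ i₀)
    have h2 : Real.exp (n * (l - ε)) ≤ y := hexp1.trans ((hn i₀ hi₀).1.le.trans h1)
    have h3 : (0 : ℝ) ≤ d / ‖x₀ - xstar‖ := by positivity
    gcongr
    linarith
  · have h1 : y ≤ d * Real.exp (n * (l + ε)) := by
      refine le_of_sq_le_sq ?_ (by positivity)
      rw [← hs, mul_pow]
      calc _ ≤ ∑ _i : Fin d, Real.exp (n * (l + ε)) ^ 2 := by
            refine Finset.sum_le_sum fun i _ => ?_
            by_cases hi : c i = 0
            · rw [hzero i hi]; simp; positivity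
            · rw [← sq_abs]
              have := (hn i hi).2.le.trans hexp2
              gcongr
        _ = d * Real.exp (n * (l + ε)) ^ 2 := by simp
        _ ≤ (d : ℝ) ^ 2 * Real.exp (n * (l + ε)) ^ 2 := by
            gcongr
            exact_mod_cast Nat.le_self_pow two_ne_zero d
    rw [div_le_iff₀ hN]
    refine h1.trans ?_
    have h4 : (d / ‖x₀ - xstar‖ + ‖x₀ - xstar‖) * Real.exp (n * (l + ε)) * ‖x₀ - xstar‖ =
        d * Real.exp (n * (l + ε)) + ‖x₀ - xstar‖ ^ 2 * Real.exp (n * (l + ε)) := by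
      field_simp
    rw [h4]
    have : 0 ≤ ‖x₀ - xstar‖ ^ 2 * Real.exp (n * (l + ε)) := by positivity
    linarith

theorem gdRate_tendsto_of_arcsine {d : ℕ} {m M : ℝ} (hm : 0 < m) (hmM : m < M) {Ω : Type*}
    [MeasurableSpace Ω] {P : Measure Ω} [IsProbabilityMeasure P] {ν : Measure ℝ}
    {α : ℕ → Ω → ℝ} (hlaw : ∀ t, HasLaw (α t) ν P)
    (hindep : iIndepFun α P) (hν : ν.map (fun a => a⁻¹) = arcsineMeasure m M)
    {f : EuclideanSpace ℝ (Fin d) → ℝ} {xstar x₀ : EuclideanSpace ℝ (Fin d)}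
    (hsep : IsSeparableFun f) (hsc : StrongConvexOn Set.univ m f) (hsm : IsSmoothFun M f)
    (hmin : IsMinOn f Set.univ xstar) (hx₀ : x₀ ≠ xstar) :
    (∀ᵐ ω ∂P, Tendsto (fun n => gdRate f xstar x₀ (fun t => α t ω) n) atTop
      (𝓝 (acceleratedRate m M))) ∧
    (∀ n, Integrable (fun ω => gdRate f xstar x₀ (fun t => α t ω) n) P) ∧
    Tendsto (fun n => ∫ ω, |gdRate f xstar x₀ (fun t => α t ω) n - acceleratedRate m M| ∂P)
      atTop (𝓝 0) := by
  -- `HasLaw` gives only a.e. measurability, so the stepsizes are replaced by measurable versions;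
  -- the two sequences agree almost surely.
  set β : ℕ → Ω → ℝ := fun t => (hlaw t).aemeasurable.mk (α t)
  have hβ : ∀ t, Measurable (β t) := fun t => (hlaw t).aemeasurable.measurable_mk
  have hαβ : ∀ t, α t =ᵐ[P] β t := fun t => (hlaw t).aemeasurable.ae_eq_mk
  have hβlaw : ∀ t, P.map (β t) = ν := fun t => by
    rw [← Measure.map_congr (hαβ t), (hlaw t).map_eq]
  have hβindep : iIndepFun β P := hindep.congr hαβ
  have heq : ∀ᵐ ω ∂P, (fun t => α t ω) = fun t => β t ω := by
    filter_upwards [ae_all_iff.2 hαβ] with ω hω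
    exact funext hω
  have hlim : ∀ᵐ ω ∂P, Tendsto (fun n => gdRate f xstar x₀ (fun t => α t ω) n) atTop
      (𝓝 (acceleratedRate m M)) := by
    filter_upwards [heq, ae_tendsto_gdRate hm hmM hβ hβlaw hβindep hν hsep hsc hsm hmin hx₀]
      with ω h1 h2
    rwa [h1]
  have hmeas : ∀ n, AEStronglyMeasurable (fun ω => gdRate f xstar x₀ (fun t => α t ω) n) P := by
    intro n
    refine ⟨_, (measurable_gdRate hsm xstar x₀ hβ n).stronglyMeasurable, ?_⟩
    filter_upwards [heq] with ω h1
    rw [h1]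
  have hbd : ∀ᵐ ω ∂P, ∀ n, gdRate f xstar x₀ (fun t => α t ω) n ≤ M / m := by
    have h1 : ∀ᵐ ω ∂P, ∀ t, (α t ω)⁻¹ ∈ Set.Ioo m M := by
      rw [ae_all_iff]
      intro t
      have h2 := ae_mem_arcsineMeasure m M
      rw [← hν, ← (hlaw t).map_eq] at h2
      exact ae_of_ae_map (hlaw t).aemeasurable
        (ae_of_ae_map measurable_inv.aemeasurable h2)
    filter_upwards [h1] with ω hω n
    exact gdRate_le_of_inv_mem hm hmM hsep hsc hsm hmin hx₀ hω n
  have hR := acceleratedRate_pos hm hmM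
  refine ⟨hlim, fun n => ?_, ?_⟩
  · refine Integrable.of_bound (hmeas n) (M / m) ?_
    filter_upwards [hbd] with ω hω
    rw [Real.norm_of_nonneg (gdRate_nonneg _ _ _ _ _)]
    exact hω n
  · have h3 := tendsto_integral_of_dominated_convergence (μ := P)
      (F := fun n ω => |gdRate f xstar x₀ (fun t => α t ω) n - acceleratedRate m M|)
      (f := fun _ => 0) (fun _ => M / m + acceleratedRate m M)
      (fun n => ((hmeas n).sub aestronglyMeasurable_const).norm) (integrable_const _)
      (fun n => by
        filter_upwards [hbd] with ω hω
        rw [Real.norm_eq_abs, abs_abs, abs_le]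
        have := gdRate_nonneg f xstar x₀ (fun t => α t ω) n
        have := hω n
        constructor <;> linarith)
      (by
        filter_upwards [hlim] with ω hω
        simpa using (hω.sub_const (acceleratedRate m M)).abs)
    simpa using h3

/-! ### Isotropic quadratics and the strong law -/

theorem hasGradientAt_const_mul_norm_sq {d : ℕ} (c : ℝ) (x : EuclideanSpace ℝ (Fin d)) :
    HasGradientAt (fun x : EuclideanSpace ℝ (Fin d) => c / 2 * ‖x‖ ^ 2) (c • x) x := by
  rw [hasGradientAt_iff_hasFDerivAt]
  refine ((hasStrictFDerivAt_norm_sq x).hasFDerivAt.const_mul (c / 2)).congr_fderiv ?_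
  ext y
  simp
  ring

theorem isSeparableFun_const_mul_norm_sq (d : ℕ) (c : ℝ) :
    IsSeparableFun fun x : EuclideanSpace ℝ (Fin d) => c / 2 * ‖x‖ ^ 2 := by
  refine ⟨1, one_mem _, fun _ t => c / 2 * t ^ 2, fun x => ?_⟩
  simp [EuclideanSpace.norm_sq_eq, Finset.mul_sum]

theorem strongConvexOn_const_mul_norm_sq (d : ℕ) {m c : ℝ} (hc : m ≤ c) :
    StrongConvexOn Set.univ m fun x : EuclideanSpace ℝ (Fin d) => c / 2 * ‖x‖ ^ 2 := by
  rw [strongConvexOn_iff_convex]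
  have h1 : ConvexOn ℝ Set.univ fun x : EuclideanSpace ℝ (Fin d) => ‖x‖ ^ 2 :=
    convexOn_univ_norm.pow (fun _ _ => norm_nonneg _) 2
  have h2 := h1.smul (c := (c - m) / 2) (by linarith)
  refine h2.congr fun x _ => ?_
  change (c - m) / 2 * ‖x‖ ^ 2 = _
  ring

theorem isSmoothFun_const_mul_norm_sq (d : ℕ) {M c : ℝ} (hc0 : 0 ≤ c) (hc : c ≤ M) :
    IsSmoothFun M fun x : EuclideanSpace ℝ (Fin d) => c / 2 * ‖x‖ ^ 2 := by
  refine ⟨fun x => (hasGradientAt_const_mul_norm_sq c x).differentiableAt, fun x y => ?_⟩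
  rw [(hasGradientAt_const_mul_norm_sq c x).gradient, (hasGradientAt_const_mul_norm_sq c y).gradient,
    ← smul_sub, norm_smul, Real.norm_of_nonneg hc0]
  gcongr

theorem isMinOn_const_mul_norm_sq (d : ℕ) {c : ℝ} (hc : 0 ≤ c) :
    IsMinOn (fun x : EuclideanSpace ℝ (Fin d) => c / 2 * ‖x‖ ^ 2) Set.univ 0 := by
  intro x _
  simp
  positivity

theorem gdIterate_const_mul_norm_sq {d : ℕ} (c : ℝ) (a : ℕ → ℝ) (x₀ : EuclideanSpace ℝ (Fin d))
    (n : ℕ) : gdIterate (fun x => c / 2 * ‖x‖ ^ 2) a x₀ n =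
      (∏ t ∈ Finset.range n, (1 - a t * c)) • x₀ := by
  induction n with
  | zero => simp [gdIterate]
  | succ n ih =>
    rw [gdIterate, (hasGradientAt_const_mul_norm_sq c _).gradient, ih, Finset.prod_range_succ]
    module

theorem gdRate_const_mul_norm_sq {d : ℕ} (c : ℝ) (a : ℕ → ℝ) {x₀ : EuclideanSpace ℝ (Fin d)}
    (hx₀ : x₀ ≠ 0) (n : ℕ) : gdRate (fun x => c / 2 * ‖x‖ ^ 2) 0 x₀ a n =
      (∏ t ∈ Finset.range n, |1 - a t * c|) ^ (1 / (n : ℝ)) := by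
  unfold gdRate
  rw [gdIterate_const_mul_norm_sq, sub_zero, sub_zero, norm_smul,
    mul_div_cancel_right₀ _ (norm_ne_zero_iff.2 hx₀), Real.norm_eq_abs, Finset.abs_prod]

/-- Truncating each factor from above only lowers the product, and it spares any assumption on the
tail of `ν`. If the truncated mean exceeded `log R`, the law of large numbers would keep the rate
above `R` by a fixed margin with probability tending to one. The condition `1 - a * c ≠ 0` avoids
the default `log 0 = 0`. -/
theorem integral_log_min_le_of_tendsto {Ω : Type*} [MeasurableSpace Ω] {P : Measure Ω}
    [IsProbabilityMeasure P] {ν : Measure ℝ} {α : ℕ → Ω → ℝ} (hlaw : ∀ t, HasLaw (α t) ν P)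
    (hindep : iIndepFun α P) {c κ R : ℝ} (hκ : 0 < κ) (hR : 0 < R)
    (hlim : ∀ ε > 0, Tendsto (fun n : ℕ =>
      P {ω | R + ε ≤ (∏ t ∈ Finset.range n, |1 - α t ω * c|) ^ (1 / (n : ℝ))}) atTop (𝓝 0))
    (hint : Integrable (fun a => Real.log (min |1 - a * c| κ)) ν)
    (hne : ∀ᵐ a ∂ν, 1 - a * c ≠ 0) :
    ∫ a, Real.log (min |1 - a * c| κ) ∂ν ≤ Real.log R := by
  set ψ : ℝ → ℝ := fun a => Real.log (min |1 - a * c| κ) with hψ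
  have hψm : Measurable ψ := by fun_prop
  set E := ∫ a, ψ a ∂ν with hE
  by_contra! hcon
  -- Half the gap; `ε` is then chosen so that `R + ε = exp (E - δ)`. Almost surely either the
  -- empirical mean is off by `δ` or the rate is at least `R + ε`, although both probabilities tend
  -- to zero.
  set δ := (E - Real.log R) / 2 with hδ
  have hδ0 : 0 < δ := by rw [hδ]; linarith
  set ε := Real.exp (E - δ) - R with hε
  have hε0 : 0 < ε := by
    have : Real.exp (Real.log R) < Real.exp (E - δ) := Real.exp_lt_exp.2 (by rw [hδ]; linarith)
    rw [Real.exp_log hR] at this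
    rw [hε]; linarith
  have hα : ∀ t, AEMeasurable (α t) P := fun t => (hlaw t).aemeasurable
  have hint0 : Integrable (ψ ∘ α 0) P := by
    rw [← integrable_map_measure hψm.aestronglyMeasurable (hα 0), (hlaw 0).map_eq]
    exact hint
  have hident : ∀ t, IdentDistrib (ψ ∘ α t) (ψ ∘ α 0) P P := fun t =>
    IdentDistrib.comp ⟨hα t, hα 0, by rw [(hlaw t).map_eq, (hlaw 0).map_eq]⟩ hψm
  have hslln := strong_law_ae_real (fun t => ψ ∘ α t) hint0
    (fun i j hij => (hindep.indepFun hij).comp hψm hψm) hident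
  have hmean : ∫ ω, (ψ ∘ α 0) ω ∂P = E := by
    rw [hE, ← (hlaw 0).map_eq, integral_map (hα 0) hψm.aestronglyMeasurable]
    rfl
  rw [hmean] at hslln
  have hmeas : ∀ n : ℕ, AEStronglyMeasurable
      (fun ω => (∑ t ∈ Finset.range n, (ψ ∘ α t) ω) / n) P := by
    intro n
    refine AEMeasurable.aestronglyMeasurable (AEMeasurable.div_const ?_ _)
    exact Finset.aemeasurable_fun_sum _ fun t _ => hψm.comp_aemeasurable (hα t)
  have hprob := tendstoInMeasure_iff_dist.1 (tendstoInMeasure_of_tendsto_ae hmeas hslln) δ hδ0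
  have hsum := (hlim ε hε0).add hprob
  rw [add_zero] at hsum
  have hgood : ∀ᵐ ω ∂P, ∀ t, 1 - α t ω * c ≠ 0 := by
    rw [ae_all_iff]
    intro t
    rw [← (hlaw t).map_eq] at hne
    exact ae_of_ae_map (hα t) hne
  have hge : ∀ᶠ n : ℕ in atTop, 1 ≤
      P {ω | R + ε ≤ (∏ t ∈ Finset.range n, |1 - α t ω * c|) ^ (1 / (n : ℝ))} +
      P {ω | δ ≤ dist ((∑ t ∈ Finset.range n, (ψ ∘ α t) ω) / n) E} := by
    filter_upwards [eventually_gt_atTop 0] with n hn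
    have hn' : (0 : ℝ) < n := Nat.cast_pos.2 hn
    rw [← measure_univ (μ := P)]
    refine le_trans ?_ (measure_union_le _ _)
    refine measure_mono_ae ?_
    filter_upwards [hgood] with ω hω _
    by_cases hB : δ ≤ dist ((∑ t ∈ Finset.range n, (ψ ∘ α t) ω) / n) E
    · exact Or.inr hB
    · left
      rw [not_le, Real.dist_eq, abs_lt] at hB
      change R + ε ≤ _
      have h1 : ∏ t ∈ Finset.range n, min |1 - α t ω * c| κ ≤
          ∏ t ∈ Finset.range n, |1 - α t ω * c| :=
        Finset.prod_le_prod (fun t _ => by positivity) fun t _ => min_le_left _ _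
      have h2 : ∏ t ∈ Finset.range n, min |1 - α t ω * c| κ =
          Real.exp (∑ t ∈ Finset.range n, (ψ ∘ α t) ω) := by
        rw [Real.exp_sum]
        refine Finset.prod_congr rfl fun t _ => ?_
        rw [Function.comp_apply, hψ]
        exact (Real.exp_log (lt_min (abs_pos.2 (hω t)) hκ)).symm
      calc R + ε = Real.exp (E - δ) := by rw [hε]; ring
        _ ≤ Real.exp ((∑ t ∈ Finset.range n, (ψ ∘ α t) ω) / n) :=
          Real.exp_le_exp.2 (by linarith [hB.1])
        _ = (∏ t ∈ Finset.range n, min |1 - α t ω * c| κ) ^ (1 / (n : ℝ)) := by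
          rw [h2, ← Real.exp_mul, mul_one_div]
        _ ≤ _ := by
          refine Real.rpow_le_rpow ?_ h1 (by positivity)
          rw [h2]
          positivity
  have := ge_of_tendsto hsum hge
  simp at this

/-! ### Averaging over the curvature for a fixed stepsize -/

/-- The logarithmic contraction of stepsize `a` on curvature `1 / s`, `s = arcsinePoint p q θ`,
truncated from above at `log (q / p)`. -/
noncomputable def truncLogContraction (p q a θ : ℝ) : ℝ :=
  Real.log (min |1 - a / arcsinePoint p q θ| (q / p))

theorem measurable_truncLogContraction (p q : ℝ) :
    Measurable fun x : ℝ × ℝ => truncLogContraction p q x.1 x.2 := by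
  have := (continuous_arcsinePoint p q).measurable
  unfold truncLogContraction
  fun_prop

theorem clamp_mem_Icc {p q : ℝ} (hpq : p < q) (a : ℝ) : max p (min q a) ∈ Set.Icc p q :=
  ⟨le_max_left _ _, max_le hpq.le (min_le_left _ _)⟩

theorem clamp_eq_self {p q a : ℝ} (ha : a ∈ Set.Icc p q) : max p (min q a) = a := by
  rw [min_eq_right ha.2, max_eq_right ha.1]

/-- A stepsize outside `[p, q]` is beaten by its nearest point of `[p, q]` on every curvature `1 /
s` simultaneously. This reduces arbitrary stepsizes to the range where equalization applies. -/
theorem abs_one_sub_clamp_div_le {p q s : ℝ} (hp : 0 < p) (a : ℝ) (hs : s ∈ Set.Ioo p q) :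
    |1 - max p (min q a) / s| ≤ |1 - a / s| ∧
      (a ∉ Set.Icc p q → |1 - max p (min q a) / s| < |1 - a / s|) := by
  have hs0 : 0 < s := hp.trans hs.1
  have hpq : p < q := hs.1.trans hs.2
  by_cases ha : a ∈ Set.Icc p q
  · rw [clamp_eq_self ha]
    exact ⟨le_rfl, fun h => absurd ha h⟩
  suffices h : |1 - max p (min q a) / s| < |1 - a / s| from ⟨h.le, fun _ => h⟩
  rw [Set.mem_Icc, not_and_or, not_le, not_le] at ha
  rcases ha with ha | ha
  · rw [min_eq_right (by linarith), max_eq_left ha.le]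
    have h1 : p / s < 1 := (div_lt_one hs0).2 hs.1
    have h2 : a / s < p / s := by gcongr
    rw [abs_of_pos (by linarith), abs_of_pos (by linarith)]
    linarith
  · rw [min_eq_left ha.le, max_eq_right hpq.le]
    have h1 : 1 < q / s := (one_lt_div hs0).2 hs.2
    have h2 : q / s < a / s := by gcongr
    rw [abs_of_neg (by linarith), abs_of_neg (by linarith)]
    linarith

theorem truncLogContraction_eq_of_mem {p q a θ : ℝ} (hp : 0 < p) (ha : a ∈ Set.Icc p q)
    (hθ : arcsinePoint p q θ ∈ Set.Ioo p q) :
    truncLogContraction p q a θ = Real.log |1 - a / arcsinePoint p q θ| := by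
  unfold truncLogContraction
  rw [min_eq_left (abs_one_sub_div_lt hp ha hθ).le]

theorem truncLogContraction_le {p q : ℝ} (hp : 0 < p) (hpq : p < q) (a θ : ℝ) :
    truncLogContraction p q a θ ≤ Real.log (q / p) := by
  have hκ : 1 < q / p := (one_lt_div hp).2 hpq
  unfold truncLogContraction
  rcases (le_min (abs_nonneg (1 - a / arcsinePoint p q θ)) (by positivity : 0 ≤ q / p)).eq_or_lt
    with h | h
  · rw [← h, Real.log_zero]
    exact (Real.log_pos hκ).le
  · exact Real.log_le_log h (min_le_right _ _)

/-- The clamped factor is strictly below `q / p`, so truncation at that level preserves both the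
comparison and its strictness. -/
theorem log_clamp_le_truncLogContraction_ae {p q : ℝ} (hp : 0 < p) (hpq : p < q) (a : ℝ) :
    ∀ᵐ θ ∂(volume.restrict (Set.Ioo 0 Real.pi)),
      Real.log |1 - max p (min q a) / arcsinePoint p q θ| ≤ truncLogContraction p q a θ ∧
        (a ∉ Set.Icc p q → Real.log |1 - max p (min q a) / arcsinePoint p q θ| <
          truncLogContraction p q a θ) := by
  filter_upwards [ae_mem_arcsinePoint hpq, arcsinePoint_ne_ae hpq (max p (min q a))] with θ hθ hne
  have hs0 : 0 < arcsinePoint p q θ := hp.trans hθ.1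
  have h1 := abs_one_sub_clamp_div_le hp a hθ
  have h2 := abs_one_sub_div_lt hp (clamp_mem_Icc hpq a) hθ
  have h3 : 0 < |1 - max p (min q a) / arcsinePoint p q θ| := by
    rw [abs_pos, sub_ne_zero]
    intro h
    rw [eq_div_iff hs0.ne', one_mul] at h
    exact hne h
  exact ⟨Real.log_le_log h3 (le_min h1.1 h2.le),
    fun ha => Real.log_lt_log h3 (lt_min (h1.2 ha) h2)⟩

theorem abs_truncLogContraction_le_ae {p q : ℝ} (hp : 0 < p) (hpq : p < q) (a : ℝ) :
    ∀ᵐ θ ∂(volume.restrict (Set.Ioo 0 Real.pi)), |truncLogContraction p q a θ| ≤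
      2 * Real.log (q / p) - Real.log |1 - max p (min q a) / arcsinePoint p q θ| := by
  have hκ : 0 < Real.log (q / p) := Real.log_pos ((one_lt_div hp).2 hpq)
  filter_upwards [log_clamp_le_truncLogContraction_ae hp hpq a] with θ hθ
  have h1 := truncLogContraction_le hp hpq a θ
  rw [abs_le]
  constructor <;> linarith [hθ.1]

theorem integrableOn_truncLogContraction {p q : ℝ} (hp : 0 < p) (hpq : p < q) (a : ℝ) :
    IntegrableOn (truncLogContraction p q a) (Set.Ioo 0 Real.pi) := by
  have h1 := integrableOn_log_abs_one_sub_div hp hpq (clamp_mem_Icc hpq a)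
  have h2 : IntegrableOn (fun _ : ℝ => 2 * Real.log (q / p)) (Set.Ioo 0 Real.pi) :=
    integrable_const _
  refine (h2.sub h1).mono' ?_ (abs_truncLogContraction_le_ae hp hpq a)
  exact ((measurable_truncLogContraction p q).comp measurable_prodMk_left).aestronglyMeasurable

/-- The bound is independent of `a`, which gives joint integrability, hence Fubini, against any
probability law `ν`. -/
theorem integral_abs_truncLogContraction_le {p q : ℝ} (hp : 0 < p) (hpq : p < q) (a : ℝ) :
    ∫ θ in Set.Ioo 0 Real.pi, |truncLogContraction p q a θ| ≤
      2 * Real.log (q / p) * Real.pi - Real.pi * Real.log (acceleratedRate p q) := by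
  have h1 := integrableOn_log_abs_one_sub_div hp hpq (clamp_mem_Icc hpq a)
  have h2 : IntegrableOn (fun _ : ℝ => 2 * Real.log (q / p)) (Set.Ioo 0 Real.pi) :=
    integrable_const _
  refine (integral_mono_ae (integrableOn_truncLogContraction hp hpq a).abs (h2.sub h1)
    (abs_truncLogContraction_le_ae hp hpq a)).trans (le_of_eq ?_)
  rw [integral_sub' h2 h1, integral_log_abs_one_sub_div hp hpq (clamp_mem_Icc hpq a)]
  simp [Real.pi_pos.le]
  ring

theorem le_integral_truncLogContraction {p q : ℝ} (hp : 0 < p) (hpq : p < q) (a : ℝ) :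
    Real.pi * Real.log (acceleratedRate p q) ≤
      ∫ θ in Set.Ioo 0 Real.pi, truncLogContraction p q a θ := by
  rw [← integral_log_abs_one_sub_div hp hpq (clamp_mem_Icc hpq a)]
  exact integral_mono_ae (integrableOn_log_abs_one_sub_div hp hpq (clamp_mem_Icc hpq a))
    (integrableOn_truncLogContraction hp hpq a)
    ((log_clamp_le_truncLogContraction_ae hp hpq a).mono fun _ h => h.1)

theorem mem_Icc_of_integral_truncLogContraction_eq {p q a : ℝ} (hp : 0 < p) (hpq : p < q)
    (h : ∫ θ in Set.Ioo 0 Real.pi, truncLogContraction p q a θ =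
      Real.pi * Real.log (acceleratedRate p q)) : a ∈ Set.Icc p q := by
  by_contra ha
  rw [← integral_log_abs_one_sub_div hp hpq (clamp_mem_Icc hpq a)] at h
  have hae := log_clamp_le_truncLogContraction_ae hp hpq a
  have heq := (integral_eq_iff_of_ae_le
    (integrableOn_log_abs_one_sub_div hp hpq (clamp_mem_Icc hpq a))
    (integrableOn_truncLogContraction hp hpq a) (hae.mono fun _ h => h.1)).1 h.symm
  have hfalse : ∀ᵐ θ ∂(volume.restrict (Set.Ioo 0 Real.pi)), False := by
    filter_upwards [hae, heq] with θ h1 h2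
    exact (h1.2 ha).ne h2
  rw [eventually_false_iff_eq_bot, ae_eq_bot, Measure.restrict_eq_zero, Real.volume_Ioo,
    ENNReal.ofReal_eq_zero] at hfalse
  linarith [Real.pi_pos]

theorem integrable_prod_truncLogContraction {p q : ℝ} (hp : 0 < p) (hpq : p < q) (ν : Measure ℝ)
    [IsProbabilityMeasure ν] :
    Integrable (fun x : ℝ × ℝ => truncLogContraction p q x.1 x.2)
      (ν.prod (volume.restrict (Set.Ioo 0 Real.pi))) := by
  have hm := (measurable_truncLogContraction p q).aestronglyMeasurable
    (μ := ν.prod (volume.restrict (Set.Ioo 0 Real.pi)))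
  rw [integrable_prod_iff hm]
  refine ⟨ae_of_all _ fun a => integrableOn_truncLogContraction hp hpq a, ?_⟩
  refine Integrable.of_bound hm.norm.integral_prod_right'
    (2 * Real.log (q / p) * Real.pi - Real.pi * Real.log (acceleratedRate p q)) ?_
  refine ae_of_all _ fun a => ?_
  rw [Real.norm_of_nonneg (integral_nonneg fun _ => norm_nonneg _)]
  exact integral_abs_truncLogContraction_le hp hpq a

/-- The double integral is at most `π * log R_acc` when `a` is integrated first and at least that
when `θ` is. Equality in the second order puts `a` in `[p, q]` almost surely; equality in the first
makes the potential of `ν` constant. -/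
theorem ae_mem_Icc_and_integral_truncLogContraction_eq {p q : ℝ} (hp : 0 < p) (hpq : p < q)
    (ν : Measure ℝ) [IsProbabilityMeasure ν]
    (h : ∀ᵐ θ ∂(volume.restrict (Set.Ioo 0 Real.pi)),
      ∫ a, truncLogContraction p q a θ ∂ν ≤ Real.log (acceleratedRate p q)) :
    (∀ᵐ a ∂ν, a ∈ Set.Icc p q) ∧ ∀ᵐ θ ∂(volume.restrict (Set.Ioo 0 Real.pi)),
      ∫ a, truncLogContraction p q a θ ∂ν = Real.log (acceleratedRate p q) := by
  set μ := (volume : Measure ℝ).restrict (Set.Ioo 0 Real.pi) with hμ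
  set l := Real.log (acceleratedRate p q) with hl
  have hint := integrable_prod_truncLogContraction hp hpq ν
  have hswap := integral_integral_swap (f := truncLogContraction p q) hint
  have hJ : Integrable (fun θ => ∫ a, truncLogContraction p q a θ ∂ν) μ := hint.integral_prod_right
  have hΦ : Integrable (fun a => ∫ θ, truncLogContraction p q a θ ∂μ) ν := hint.integral_prod_left
  have hcμ : ∫ _θ, l ∂μ = Real.pi * l := by simp [hμ, Real.pi_pos.le]
  have hcν : ∫ _a, Real.pi * l ∂ν = Real.pi * l := by simp
  have h1 : ∫ θ, ∫ a, truncLogContraction p q a θ ∂ν ∂μ ≤ Real.pi * l :=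
    (integral_mono_ae hJ (by simp [hμ]) h).trans_eq hcμ
  have h2 : Real.pi * l ≤ ∫ a, ∫ θ, truncLogContraction p q a θ ∂μ ∂ν :=
    hcν.symm.trans_le (integral_mono (integrable_const _) hΦ
      fun a => le_integral_truncLogContraction hp hpq a)
  constructor
  · have h3 := (integral_eq_iff_of_ae_le (integrable_const (Real.pi * l)) hΦ
      (ae_of_all _ fun a => le_integral_truncLogContraction hp hpq a)).1 (by linarith)
    filter_upwards [h3] with a ha
    exact mem_Icc_of_integral_truncLogContraction_eq hp hpq ha.symm
  · exact (integral_eq_iff_of_ae_le hJ (by simp [hμ]) h).1 (by linarith)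

/-! ### Chebyshev moments and identification of the law -/

/-- With `a = arcsinePoint p q φ` the integrand is a constant, plus `log |cos φ - cos θ|`, minus a
term free of `a`. The constant is orthogonal to `cos (n * θ)`, and the diagonal kernel turns the
second term into `cos (n * φ)`, the value of `T n`. -/
theorem integral_truncLogContraction_mul_cos {p q a : ℝ} (hp : 0 < p) (hpq : p < q)
    (ha : a ∈ Set.Icc p q) {n : ℕ} (hn : n ≠ 0) :
    ∫ θ in Set.Ioo 0 Real.pi, truncLogContraction p q a θ * Real.cos (n * θ) =
      -(Real.pi / n) * (Polynomial.Chebyshev.T ℝ n).eval ((a - (p + q) / 2) / ((q - p) / 2)) -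
        ∫ θ in Set.Ioo 0 Real.pi, Real.log (arcsinePoint p q θ) * Real.cos (n * θ) := by
  obtain ⟨φ, -, rfl⟩ := exists_arcsinePoint_eq hpq ha
  have hb : 0 < (q - p) / 2 := by linarith
  have hn' : (n : ℝ) ≠ 0 := Nat.cast_ne_zero.2 hn
  have hT : (arcsinePoint p q φ - (p + q) / 2) / ((q - p) / 2) = Real.cos φ := by
    unfold arcsinePoint
    rw [add_sub_cancel_left, mul_div_cancel_left₀ _ hb.ne']
  have hcos : ∫ θ in Set.Ioo 0 Real.pi, Real.log ((q - p) / 2) * Real.cos (n * θ) = 0 := by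
    rw [integral_const_mul, ← integral_Ioc_eq_integral_Ioo,
      ← intervalIntegral.integral_of_le Real.pi_pos.le,
      intervalIntegral.integral_comp_mul_left (fun x => Real.cos x) hn']
    simp [Real.sin_nat_mul_pi]
  have hae : ∀ᵐ θ ∂(volume.restrict (Set.Ioo 0 Real.pi)),
      truncLogContraction p q (arcsinePoint p q φ) θ * Real.cos (n * θ) =
        (Real.log ((q - p) / 2) * Real.cos (n * θ) +
          Real.log |Real.cos φ - Real.cos θ| * Real.cos (n * θ)) -
        Real.log (arcsinePoint p q θ) * Real.cos (n * θ) := by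
    filter_upwards [log_abs_one_sub_div_ae (x := arcsinePoint p q φ) hp hpq,
      ae_mem_arcsinePoint hpq, arcsinePoint_ne_ae hpq (arcsinePoint p q φ)] with θ h1 h2 h3
    have h4 : arcsinePoint p q φ - arcsinePoint p q θ =
        (q - p) / 2 * (Real.cos φ - Real.cos θ) := by unfold arcsinePoint; ring
    have h5 : Real.cos φ - Real.cos θ ≠ 0 := by
      intro h
      rw [h, mul_zero] at h4
      exact h3 (sub_eq_zero.1 h4).symm
    rw [truncLogContraction_eq_of_mem hp ha h2, h1, h4, abs_mul,
      Real.log_mul (abs_pos.2 hb.ne').ne' (abs_ne_zero.2 h5), abs_of_pos hb]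
    ring
  have hmulcos : ∀ {g : ℝ → ℝ}, IntegrableOn g (Set.Ioo 0 Real.pi) →
      IntegrableOn (fun θ => g θ * Real.cos (n * θ)) (Set.Ioo 0 Real.pi) := by
    intro g hg
    refine hg.mul_bdd (c := 1) (by fun_prop) (ae_of_all _ fun θ => ?_)
    exact Real.abs_cos_le_one _
  have hi1 : IntegrableOn (fun θ => Real.log |Real.cos φ - Real.cos θ|) (Set.Ioo 0 Real.pi) := by
    have := integrableOn_log_abs_sub_arcsinePoint (p := -1) (q := 1) (x := Real.cos φ)
      (by norm_num) (Real.cos_mem_Icc φ)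
    simpa [arcsinePoint] using this
  have hi2 : IntegrableOn (fun _ : ℝ => Real.log ((q - p) / 2)) (Set.Ioo 0 Real.pi) := by simp
  have hi3 : IntegrableOn (fun θ => Real.log ((q - p) / 2) * Real.cos (n * θ) +
      Real.log |Real.cos φ - Real.cos θ| * Real.cos (n * θ)) (Set.Ioo 0 Real.pi) :=
    (hmulcos hi2).add (hmulcos hi1)
  rw [integral_congr_ae hae, integral_sub hi3 (hmulcos (integrableOn_log_arcsinePoint hp hpq)),
    integral_add (hmulcos hi2) (hmulcos hi1), hcos, zero_add,
    integral_log_cos_sub_cos_mul_cos_of_ne_zero hn, hT]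
  have := Polynomial.Chebyshev.T_real_cos φ (n : ℤ)
  rw [this]
  simp

/-- Testing the constant potential against `cos (n * θ)` kills `l`, and Fubini leaves the Chebyshev
moment of `ν`. The right-hand side no longer mentions `ν`, so any two solutions share these moments.
-/
theorem integral_chebyshev_eq {p q l : ℝ} (hp : 0 < p) (hpq : p < q) (ν : Measure ℝ)
    [IsProbabilityMeasure ν] (hsupp : ∀ᵐ a ∂ν, a ∈ Set.Icc p q)
    (h : ∀ᵐ θ ∂(volume.restrict (Set.Ioo 0 Real.pi)), ∫ a, truncLogContraction p q a θ ∂ν = l)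
    {n : ℕ} (hn : n ≠ 0) :
    ∫ a, (Polynomial.Chebyshev.T ℝ n).eval ((a - (p + q) / 2) / ((q - p) / 2)) ∂ν =
      -(n / Real.pi) * ∫ θ in Set.Ioo 0 Real.pi,
        Real.log (arcsinePoint p q θ) * Real.cos (n * θ) := by
  set D := ∫ θ in Set.Ioo 0 Real.pi, Real.log (arcsinePoint p q θ) * Real.cos (n * θ)
  set T : ℝ → ℝ := fun a =>
    (Polynomial.Chebyshev.T ℝ n).eval ((a - (p + q) / 2) / ((q - p) / 2)) with hT
  have hpi := Real.pi_pos
  have hn' : (n : ℝ) ≠ 0 := Nat.cast_ne_zero.2 hn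
  have hint : Integrable (fun x : ℝ × ℝ => truncLogContraction p q x.1 x.2 * Real.cos (n * x.2))
      (ν.prod (volume.restrict (Set.Ioo 0 Real.pi))) := by
    refine (integrable_prod_truncLogContraction hp hpq ν).mul_bdd (c := 1) ?_
      (ae_of_all _ fun x => Real.abs_cos_le_one _)
    exact Continuous.aestronglyMeasurable (by fun_prop)
  have hswap := integral_integral_swap
    (f := fun a θ => truncLogContraction p q a θ * Real.cos (n * θ)) hint
  have hcos : ∫ θ in Set.Ioo 0 Real.pi, l * Real.cos (n * θ) = 0 := by
    rw [integral_const_mul, ← integral_Ioc_eq_integral_Ioo,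
      ← intervalIntegral.integral_of_le Real.pi_pos.le,
      intervalIntegral.integral_comp_mul_left (fun x => Real.cos x) hn']
    simp [Real.sin_nat_mul_pi]
  have hright : ∫ θ in Set.Ioo 0 Real.pi,
      ∫ a, truncLogContraction p q a θ * Real.cos (n * θ) ∂ν = 0 := by
    refine Eq.trans (integral_congr_ae ?_) hcos
    filter_upwards [h] with θ hθ
    rw [integral_mul_const, hθ]
  have hleft : ∫ a, (∫ θ in Set.Ioo 0 Real.pi, truncLogContraction p q a θ * Real.cos (n * θ)) ∂ν =
      ∫ a, (-(Real.pi / n) * T a - D) ∂ν := by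
    refine integral_congr_ae ?_
    filter_upwards [hsupp] with a ha
    exact integral_truncLogContraction_mul_cos hp hpq ha hn
  have hTint : Integrable T ν := by
    have hcont : Continuous T := by rw [hT]; fun_prop
    obtain ⟨C, hC⟩ := isCompact_Icc.exists_bound_of_continuousOn (hcont.continuousOn (s := Set.Icc p q))
    exact Integrable.of_bound hcont.aestronglyMeasurable C (hsupp.mono hC)
  rw [hleft, hright, integral_sub (hTint.const_mul _) (integrable_const _), integral_const_mul] at hswap
  simp only [integral_const, probReal_univ, smul_eq_mul, one_mul] at hswap
  have h3 : Real.pi / n * ∫ a, T a ∂ν = -D := by linarith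
  rw [div_mul_eq_mul_div, div_eq_iff hn'] at h3
  field_simp
  linarith

theorem span_range_chebyshev_T_eq_top :
    Submodule.span ℝ (Set.range (Polynomial.Chebyshev.T ℝ)) = ⊤ := by
  set W := Submodule.span ℝ (Set.range (Polynomial.Chebyshev.T ℝ)) with hW
  have hX : ∀ P ∈ W, Polynomial.X * P ∈ W := by
    intro P hP
    induction hP using Submodule.span_induction with
    | mem P hP =>
      obtain ⟨n, rfl⟩ := hP
      have h1 := Polynomial.Chebyshev.T_add_two ℝ (n - 1)
      -- The three-term recurrence makes the span stable under multiplication by `X`; as `T 0 = 1`,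
      -- it contains all powers of `X`.
      have h2 : Polynomial.X * Polynomial.Chebyshev.T ℝ n = (1 / 2 : ℝ) •
          (Polynomial.Chebyshev.T ℝ (n - 1 + 2) + Polynomial.Chebyshev.T ℝ (n - 1)) := by
        rw [h1, sub_add_cancel, sub_add_cancel, mul_assoc, two_mul, ← two_smul ℝ, smul_smul]
        norm_num
      rw [h2]
      exact W.smul_mem _ (W.add_mem (Submodule.subset_span ⟨_, rfl⟩)
        (Submodule.subset_span ⟨_, rfl⟩))
    | zero => simp
    | add P Q _ _ hP hQ => rw [mul_add]; exact W.add_mem hP hQ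
    | smul c P _ hP => rw [mul_smul_comm]; exact W.smul_mem c hP
  have hpow : ∀ n : ℕ, (Polynomial.X ^ n : Polynomial ℝ) ∈ W := by
    intro n
    induction n with
    | zero =>
      rw [pow_zero, ← Polynomial.Chebyshev.T_zero ℝ]
      exact Submodule.subset_span ⟨_, rfl⟩
    | succ n ih => rw [pow_succ']; exact hX _ ih
  rw [eq_top_iff]
  intro P _
  induction P using Polynomial.induction_on' with
  | add P Q hP hQ => exact W.add_mem (hP trivial) (hQ trivial)
  | monomial n a =>
    rw [← Polynomial.C_mul_X_pow_eq_monomial, ← Polynomial.smul_eq_C_mul]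
    exact W.smul_mem a (hpow n)

theorem ext_of_integral_polynomial_eq {p q : ℝ} {ν ν' : Measure ℝ}
    [IsProbabilityMeasure ν] [IsProbabilityMeasure ν'] (hν : ∀ᵐ a ∂ν, a ∈ Set.Icc p q)
    (hν' : ∀ᵐ a ∂ν', a ∈ Set.Icc p q)
    (h : ∀ Q : Polynomial ℝ, ∫ a, Q.eval a ∂ν = ∫ a, Q.eval a ∂ν') : ν = ν' := by
  refine ext_of_forall_integral_eq_of_IsFiniteMeasure fun g => ?_
  have key : ∀ ε > 0, |∫ a, g a ∂ν - ∫ a, g a ∂ν'| ≤ 2 * ε := by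
    intro ε hε
    obtain ⟨Q, hQ⟩ := exists_polynomial_near_of_continuousOn p q g g.continuous.continuousOn ε hε
    have hclose : ∀ μ : Measure ℝ, IsProbabilityMeasure μ → (∀ᵐ a ∂μ, a ∈ Set.Icc p q) →
        |∫ a, Q.eval a ∂μ - ∫ a, g a ∂μ| ≤ ε := by
      intro μ _ hμ
      have hQi : Integrable (fun a => Q.eval a) μ := by
        obtain ⟨C, hC⟩ := isCompact_Icc.exists_bound_of_continuousOn
          (Q.continuous.continuousOn (s := Set.Icc p q))
        exact Integrable.of_bound Q.continuous.aestronglyMeasurable C (hμ.mono hC)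
      rw [← integral_sub hQi (g.integrable μ), ← Real.norm_eq_abs]
      refine (norm_integral_le_of_norm_le_const (C := ε) (hμ.mono fun a ha => (hQ a ha).le)).trans ?_
      simp
    have h1 := abs_le.1 (hclose ν inferInstance hν)
    have h2 := abs_le.1 (hclose ν' inferInstance hν')
    have h3 := h Q
    rw [abs_le]
    constructor <;> linarith [h1.1, h1.2, h2.1, h2.2]
  have h0 : |∫ a, g a ∂ν - ∫ a, g a ∂ν'| ≤ 0 := by
    refine le_of_forall_pos_le_add fun ε hε => ?_
    have := key (ε / 2) (by positivity)
    linarith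
  exact sub_eq_zero.1 (abs_nonpos_iff.1 h0)

theorem ext_of_integral_chebyshev_eq {p q : ℝ} (hpq : p < q) {ν ν' : Measure ℝ}
    [IsProbabilityMeasure ν] [IsProbabilityMeasure ν'] (hν : ∀ᵐ a ∂ν, a ∈ Set.Icc p q)
    (hν' : ∀ᵐ a ∂ν', a ∈ Set.Icc p q)
    (h : ∀ n : ℕ, n ≠ 0 →
      ∫ a, (Polynomial.Chebyshev.T ℝ n).eval ((a - (p + q) / 2) / ((q - p) / 2)) ∂ν =
      ∫ a, (Polynomial.Chebyshev.T ℝ n).eval ((a - (p + q) / 2) / ((q - p) / 2)) ∂ν') :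
    ν = ν' := by
  have hb : (q - p) / 2 ≠ 0 := by have : 0 < q - p := by linarith
                                  positivity
  have hint : ∀ (μ : Measure ℝ) [IsProbabilityMeasure μ], (∀ᵐ a ∂μ, a ∈ Set.Icc p q) →
      ∀ Q : Polynomial ℝ, Integrable (fun a => Q.eval ((a - (p + q) / 2) / ((q - p) / 2))) μ := by
    intro μ _ hμ Q
    have hcont : Continuous fun a => Q.eval ((a - (p + q) / 2) / ((q - p) / 2)) := by fun_prop
    obtain ⟨C, hC⟩ := isCompact_Icc.exists_bound_of_continuousOn
      (hcont.continuousOn (s := Set.Icc p q))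
    exact Integrable.of_bound hcont.aestronglyMeasurable C (hμ.mono hC)
  have hall : ∀ Q : Polynomial ℝ, ∫ a, Q.eval ((a - (p + q) / 2) / ((q - p) / 2)) ∂ν =
      ∫ a, Q.eval ((a - (p + q) / 2) / ((q - p) / 2)) ∂ν' := by
    intro Q
    have hQ : Q ∈ Submodule.span ℝ (Set.range (Polynomial.Chebyshev.T ℝ)) := by
      rw [span_range_chebyshev_T_eq_top]; trivial
    induction hQ using Submodule.span_induction with
    | mem P hP =>
      obtain ⟨n, rfl⟩ := hP
      rw [← Polynomial.Chebyshev.T_natAbs]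
      rcases eq_or_ne n.natAbs 0 with h0 | h0
      · rw [h0]; simp
      · exact h _ h0
    | zero => simp
    | add P Q _ _ hP hQ =>
      simp only [Polynomial.eval_add]
      rw [integral_add (hint ν hν P) (hint ν hν Q), integral_add (hint ν' hν' P) (hint ν' hν' Q),
        hP, hQ]
    | smul c P _ hP =>
      simp only [Polynomial.eval_smul, smul_eq_mul]
      rw [integral_const_mul, integral_const_mul, hP]
  refine ext_of_integral_polynomial_eq hν hν' fun Q => ?_
  have h1 := hall (Q.comp (Polynomial.C ((q - p) / 2) * Polynomial.X + Polynomial.C ((p + q) / 2)))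
  have h2 : ∀ a : ℝ, (q - p) / 2 * ((a - (p + q) / 2) / ((q - p) / 2)) + (p + q) / 2 = a := by
    intro a
    rw [mul_div_cancel₀ _ hb, sub_add_cancel]
  simpa [h2] using h1

/-- For `a = 1 / b` and `s = 1 / x`, `a / s = x / b`, so this is equalization on `[m, M]` again.
Having one known solution of the moment equations makes it unnecessary to evaluate the moments. -/
theorem map_inv_arcsineMeasure_spec {m M : ℝ} (hm : 0 < m) (hmM : m < M) :
    (∀ᵐ a ∂((arcsineMeasure m M).map fun b => b⁻¹), a ∈ Set.Icc M⁻¹ m⁻¹) ∧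
      ∀ᵐ θ ∂(volume.restrict (Set.Ioo 0 Real.pi)),
        ∫ a, truncLogContraction M⁻¹ m⁻¹ a θ ∂((arcsineMeasure m M).map fun b => b⁻¹) =
          Real.log (acceleratedRate M⁻¹ m⁻¹) := by
  have hM : 0 < M := hm.trans hmM
  have hinv : ∀ {b}, b ∈ Set.Ioo m M → b⁻¹ ∈ Set.Icc M⁻¹ m⁻¹ := fun {b} hb =>
    ⟨inv_anti₀ (hm.trans hb.1) hb.2.le, inv_anti₀ hm hb.1.le⟩
  have hpq : M⁻¹ < m⁻¹ := inv_strictAnti₀ hm hmM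
  constructor
  · refine (ae_map_iff measurable_inv.aemeasurable measurableSet_Icc).2 ?_
    filter_upwards [ae_mem_arcsineMeasure m M] with b hb
    exact hinv hb
  · filter_upwards [ae_mem_arcsinePoint hpq] with θ hθ
    set s := arcsinePoint M⁻¹ m⁻¹ θ
    have hs0 : 0 < s := (inv_pos.2 hM).trans hθ.1
    have hs : s⁻¹ ∈ Set.Icc m M := by
      constructor
      · rw [le_inv_comm₀ hm hs0]; exact hθ.2.le
      · rw [inv_le_comm₀ hs0 hM]; exact hθ.1.le
    have hmeas : Measurable fun a => truncLogContraction M⁻¹ m⁻¹ a θ :=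
      (measurable_truncLogContraction _ _).comp measurable_prodMk_right
    rw [integral_map measurable_inv.aemeasurable hmeas.aestronglyMeasurable,
      acceleratedRate_inv, ← integral_log_arcsineMeasure hm hmM hs]
    refine integral_congr_ae ?_
    filter_upwards [ae_mem_arcsineMeasure m M] with b hb
    rw [truncLogContraction_eq_of_mem (inv_pos.2 hM) (hinv hb) hθ, div_eq_mul_inv, div_eq_mul_inv,
      mul_comm]

theorem map_inv_eq_arcsineMeasure_of_gdRate {d : ℕ} (hd : 1 ≤ d) {m M : ℝ} (hm : 0 < m)
    (hmM : m < M) {Ω : Type*} [MeasurableSpace Ω] {P : Measure Ω} [IsProbabilityMeasure P]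
    {ν : Measure ℝ} {α : ℕ → Ω → ℝ} (hlaw : ∀ t, HasLaw (α t) ν P) (hindep : iIndepFun α P)
    (h : ∀ (f : EuclideanSpace ℝ (Fin d) → ℝ) (xstar x₀ : EuclideanSpace ℝ (Fin d)),
        IsSeparableFun f → StrongConvexOn Set.univ m f → IsSmoothFun M f →
        IsMinOn f Set.univ xstar → x₀ ≠ xstar →
          ∀ ε > 0, Tendsto
            (fun n => P {ω | acceleratedRate m M + ε ≤ gdRate f xstar x₀ (fun t => α t ω) n})
            atTop (𝓝 0)) :
    ν.map (fun a => a⁻¹) = arcsineMeasure m M := by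
  have hM : 0 < M := hm.trans hmM
  have hp : 0 < M⁻¹ := inv_pos.2 hM
  have hpq : M⁻¹ < m⁻¹ := inv_strictAnti₀ hm hmM
  have hν : IsProbabilityMeasure ν := by
    rw [← (hlaw 0).map_eq]
    exact Measure.isProbabilityMeasure_map (hlaw 0).aemeasurable
  have hκ : 0 < m⁻¹ / M⁻¹ := div_pos (inv_pos.2 hm) hp
  have hint := (integrable_prod_truncLogContraction hp hpq ν).prod_left_ae
  -- `ν` may have atoms, but each `a` is hit only for a null set of `θ`; exchanging quantifiers by
  -- Fubini, almost every curvature avoids them.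
  have hne : ∀ᵐ θ ∂(volume.restrict (Set.Ioo 0 Real.pi)), ∀ᵐ a ∂ν,
      arcsinePoint M⁻¹ m⁻¹ θ ≠ a := by
    refine (Measure.ae_ae_comm ?_).1 (ae_of_all ν fun a => arcsinePoint_ne_ae hpq a)
    have := (continuous_arcsinePoint M⁻¹ m⁻¹).measurable
    exact (measurableSet_eq_fun (this.comp measurable_snd) measurable_fst).compl
  have hle : ∀ᵐ θ ∂(volume.restrict (Set.Ioo 0 Real.pi)),
      ∫ a, truncLogContraction M⁻¹ m⁻¹ a θ ∂ν ≤ Real.log (acceleratedRate M⁻¹ m⁻¹) := by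
    filter_upwards [ae_mem_arcsinePoint hpq, hint, hne] with θ hθ hi hne
    rw [acceleratedRate_inv]
    have hs0 : 0 < arcsinePoint M⁻¹ m⁻¹ θ := hp.trans hθ.1
    have hc0 : m ≤ (arcsinePoint M⁻¹ m⁻¹ θ)⁻¹ := by rw [le_inv_comm₀ hm hs0]; exact hθ.2.le
    have hc1 : (arcsinePoint M⁻¹ m⁻¹ θ)⁻¹ ≤ M := by rw [inv_le_comm₀ hs0 hM]; exact hθ.1.le
    simp only [truncLogContraction, div_eq_mul_inv _ (arcsinePoint M⁻¹ m⁻¹ θ)] at hi ⊢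
    generalize hcs : (arcsinePoint M⁻¹ m⁻¹ θ)⁻¹ = c at *
    have hx₀ : EuclideanSpace.single (⟨0, hd⟩ : Fin d) (1 : ℝ) ≠ 0 := by simp
    refine integral_log_min_le_of_tendsto hlaw hindep hκ (acceleratedRate_pos hm hmM)
      (fun ε hε => ?_) hi ?_
    · have h1 := h _ 0 _ (isSeparableFun_const_mul_norm_sq d c)
        (strongConvexOn_const_mul_norm_sq d hc0)
        (isSmoothFun_const_mul_norm_sq d (hm.le.trans hc0) hc1)
        (isMinOn_const_mul_norm_sq d (hm.le.trans hc0)) hx₀ ε hε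
      simpa only [gdRate_const_mul_norm_sq c _ hx₀] using h1
    · filter_upwards [hne] with a ha h0
      apply ha
      rw [sub_eq_zero, ← hcs, ← div_eq_mul_inv, eq_div_iff hs0.ne', one_mul] at h0
      exact h0
  obtain ⟨hsupp, heq⟩ := ae_mem_Icc_and_integral_truncLogContraction_eq hp hpq ν hle
  obtain ⟨hsupp', heq'⟩ := map_inv_arcsineMeasure_spec hm hmM
  have := isProbabilityMeasure_arcsineMeasure hmM
  have hprob : IsProbabilityMeasure ((arcsineMeasure m M).map fun b => b⁻¹) :=
    Measure.isProbabilityMeasure_map measurable_inv.aemeasurable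
  have hfinal : ν = (arcsineMeasure m M).map fun b => b⁻¹ :=
    ext_of_integral_chebyshev_eq hpq hsupp hsupp' fun n hn => by
      rw [integral_chebyshev_eq hp hpq ν hsupp heq hn,
        integral_chebyshev_eq hp hpq _ hsupp' heq' hn]
  exact (eq_map_inv_of_map_inv_eq hfinal.symm).symm

/-- Gradient descent with i.i.d. stepsizes `α t` of law `ν`, in dimension `d ≥ 1`.
First part: if the inverse stepsizes are Arcsine on `(m, M)`, then the rate converges to the
accelerated rate, almost surely and in `L¹`, for every separable `m`-strongly convex `M`-smooth
objective and every start other than the minimizer.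
Second part: if, for all these objectives and starts, the rate is asymptotically at most the
accelerated rate even just in probability (which almost sure convergence and `L¹` convergence both
imply), then the inverse stepsizes are Arcsine on `(m, M)`. -/
theorem theorem1 (d : ℕ) (hd : 1 ≤ d) (m M : ℝ) (hm : 0 < m) (hmM : m < M)
    {Ω : Type*} [MeasurableSpace Ω] (P : Measure Ω) [IsProbabilityMeasure P]
    (ν : Measure ℝ) (α : ℕ → Ω → ℝ)
    (hlaw : ∀ t, HasLaw (α t) ν P) (hindep : iIndepFun α P) :
    (ν.map (fun a => a⁻¹) = arcsineMeasure m M →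
      ∀ (f : EuclideanSpace ℝ (Fin d) → ℝ) (xstar x₀ : EuclideanSpace ℝ (Fin d)),
        IsSeparableFun f → StrongConvexOn Set.univ m f → IsSmoothFun M f →
        IsMinOn f Set.univ xstar → x₀ ≠ xstar →
          (∀ᵐ ω ∂P, Tendsto (fun n => gdRate f xstar x₀ (fun t => α t ω) n) atTop
            (𝓝 (acceleratedRate m M))) ∧
          (∀ n, Integrable (fun ω => gdRate f xstar x₀ (fun t => α t ω) n) P) ∧
          Tendsto (fun n => ∫ ω, |gdRate f xstar x₀ (fun t => α t ω) n - acceleratedRate m M| ∂P)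
            atTop (𝓝 0)) ∧
    ((∀ (f : EuclideanSpace ℝ (Fin d) → ℝ) (xstar x₀ : EuclideanSpace ℝ (Fin d)),
        IsSeparableFun f → StrongConvexOn Set.univ m f → IsSmoothFun M f →
        IsMinOn f Set.univ xstar → x₀ ≠ xstar →
          ∀ ε > 0, Tendsto
            (fun n => P {ω | acceleratedRate m M + ε ≤ gdRate f xstar x₀ (fun t => α t ω) n})
            atTop (𝓝 0)) →
      ν.map (fun a => a⁻¹) = arcsineMeasure m M) :=
  ⟨fun hν _ _ _ hsep hsc hsm hmin hx₀ =>
    gdRate_tendsto_of_arcsine hm hmM hlaw hindep hν hsep hsc hsm hmin hx₀,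
    map_inv_eq_arcsineMeasure_of_gdRate hd hm hmM hlaw hindep⟩
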